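/- **The systems.** Let $\mathcal I$ (customer types) and $\mathcal J$ (server types) be finite sets and let $\mathcal E\subseteq\mathcal I\times\mathcal J$ be the set of allowed activities. Put $\mathcal S(i)=\{j:(i,j)\in\mathcal E\}$ and $\mathcal C(j)=\{i:(i,j)\in\mathcal E\}$. Let $\lambda_i>0$, $\beta_j>0$ and $\mu_{ij}>0$ for $(i,j)\in\mathcal E$. Below, $\sum_j\xi_{ij}$ means $\sum_{j\in\mathcal S(i)}\xi_{ij}$ and $\sum_i\xi_{ij}$ means $\sum_{i\in\mathcal C(j)}\xi_{ij}$. Consider a sequence of systems indexed by a parameter $r>0$ that runs through a sequence tending to $\infty$. In system $r$, pool $j$ has $r\beta_j$ (an integer number of) servers, type $i$ customers arrive at rate $\lambda_i^r=r\lambda_i+o(r)$, $\lambda_i^r\ge 0$, and the service of a type $i$ customer by a type $j$ server is exponential of rate $\mu_{ij}$. The systems are driven by common independent unit-rate Poisson processes $\Pi^{(a)}_i$, $i\in\mathcal I$, and $\Pi^{(s)}_{ij}$, $(i,j)\in\mathcal E$: the number of type $i$ arrivals by time $t$ is $A^r_i(t)=\Pi^{(a)}_i(\lambda^r_it)$,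 and the number of service completions of type $i$ customers in pool $j$ by time $t$ is $S^r_{ij}\big(\tfrac1r\int_0^t\Psi^r_{ij}(s)\,ds\big)$ with $S^r_{ij}(t)=\Pi^{(s)}_{ij}(\mu_{ij}rt)$. Here $\Psi^r_{ij}(t)$ is the number of type $j$ servers that serve type $i$ customers at time $t$. Let $Q^r_i(t)$ be the number of type $i$ customers waiting at time $t$, $X^r_i=Q^r_i+\sum_j\Psi^r_{ij}$ and $\Xi^r_j=\frac1{\beta_j}\sum_i\Psi^r_{ij}$. **The policy LQFS-LB.** A type $i$ customer who on arrival finds an unoccupied server in some pool in $\mathcal S(i)$ is immediately taken into service in a pool $j\in\arg\min_{j\in\mathcal S(i)}\Xi^r_j$; otherwise the customer joins queue $i$. A type $j$ server who completes a service and finds a nonempty queue of a type in $\mathcal C(j)$ immediately takes a customer from a queue $i\in\arg\max_{i\in\mathcal C(j)}Q^r_i$; otherwise the server becomes idle. Ties are broken arbitrarily. The initial states (possibly random) are feasible for the policy: $\Psi^r_{ij}(0)=0$ if $(i,j)\notin\mathcal E$, $\sum_i\Psi^r_{ij}(0)\le r\beta_j$ for all $j$, and $\sum_{i'}\Psi^r_{i'j}(0)=r\beta_j$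 whenever $Q^r_i(0)>0$ for some $i\in\mathcal C(j)$. **Fluid models.** A *fluid model* is a set of Lipschitz continuous functions $\{(a_i(\cdot)),(x_i(\cdot)),(q_i(\cdot)),(\psi_{ij}(\cdot))_{(i,j)\in\mathcal E},(\rho_j(\cdot))\}$ on $[0,\infty)$ such that, for all $t\ge 0$, $i\in\mathcal I$ and $j\in\mathcal J$: 1. $a_i(t)=\lambda_it$; 2. $x_i(t)=q_i(t)+\sum_j\psi_{ij}(t)$; 3. $x_i(t)=x_i(0)+a_i(t)-\sum_j\int_0^t\mu_{ij}\psi_{ij}(s)\,ds$; 4. $\rho_j(t)=\frac1{\beta_j}\sum_i\psi_{ij}(t)$; 5. $\rho_j(t)=1$ if $q_{i'}(t)>0$ for some $i'\in\mathcal C(j)$; 6. for all $\mathcal J^*\subseteq\mathcal J$ and $\mathcal I^*\subseteq\mathcal I$ such that $q_i(t)>0$ for all $i\in\mathcal I^*$, and $q_i(t)>q_{i'}(t)$ whenever $i\in\mathcal I^*$, $i'\notin\mathcal I^*$ and $\mathcal S(i)\cap\mathcal S(i')\cap\mathcal J^*\ne\emptyset$, $$\sum_{i\in\mathcal I^*}\sum_{j\in\mathcal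 S(i)\cap\mathcal J^*}\dot\psi_{ij}(t)=\sum_{j\in\bigcup_{i\in\mathcal I^*}\mathcal S(i)\cap\mathcal J^*}\ \sum_{i'\in\mathcal C(j)}\mu_{i'j}\psi_{i'j}(t)-\sum_{i\in\mathcal I^*}\sum_{j\in\mathcal S(i)\cap\mathcal J^*}\mu_{ij}\psi_{ij}(t);$$ 7. for all $\mathcal I_*\subseteq\mathcal I$ and $\mathcal J_*\subseteq\mathcal J$ such that $\rho_j(t)<1$ for all $j\in\mathcal J_*$, and $\rho_j(t)<\rho_{j'}(t)$ whenever $j\in\mathcal J_*$, $j'\notin\mathcal J_*$ and $\mathcal C(j)\cap\mathcal C(j')\cap\mathcal I_*\ne\emptyset$, $$\sum_{j\in\mathcal J_*}\sum_{i\in\mathcal C(j)\cap\mathcal I_*}\dot\psi_{ij}(t)=\sum_{i\in\bigcup_{j\in\mathcal J_*}\mathcal C(j)\cap\mathcal I_*}\lambda_i-\sum_{j\in\mathcal J_*}\sum_{i\in\mathcal C(j)\cap\mathcal I_*}\mu_{ij}\psi_{ij}(t).$$ Equations 6 and 7 are required at all $t\ge0$ at which the derivatives that occur in them exist (right derivatives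 at $t=0$). **Theorem.** Let $a^r_i=\frac1rA^r_i$, $x^r_i=\frac1rX^r_i$, $q^r_i=\frac1rQ^r_i$, $\psi^r_{ij}=\frac1r\Psi^r_{ij}$ and $\rho^r_j=\frac1r\Xi^r_j$. Suppose that, as $r\to\infty$, with probability 1, $$\{(x^r_i(0)),(q^r_i(0)),(\psi^r_{ij}(0)),(\rho^r_j(0))\}\to\{(x_i(0)),(q_i(0)),(\psi_{ij}(0)),(\rho_j(0))\}.$$ Then, with probability 1, any subsequence of $\{r\}$ contains a further subsequence along which, uniformly on compact subsets of $[0,\infty)$, $$\{(a^r_i(\cdot)),(x^r_i(\cdot)),(q^r_i(\cdot)),(\psi^r_{ij}(\cdot)),(\rho^r_j(\cdot))\}\to\{(a_i(\cdot)),(x_i(\cdot)),(q_i(\cdot)),(\psi_{ij}(\cdot)),(\rho_j(\cdot))\},$$ where the limit is a fluid model (with the given initial state). -/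

import Mathlib

open MeasureTheory ProbabilityTheory Filter Topology
open scoped NNReal

namespace LQFS

/-- A Poisson process of unit rate on `[0, ∞)`: a counting process started at `0` with
nondecreasing right-continuous paths and independent increments, the increment over `(s, t]` being
Poisson with mean `t - s`. -/
structure IsUnitPoissonProcess {Ω : Type*} [MeasurableSpace Ω] (P : Measure Ω)
    (N : ℝ≥0 → Ω → ℕ) : Prop where
  measurable : ∀ t, Measurable (N t)
  paths : ∀ᵐ ω ∂P, N 0 ω = 0 ∧ Monotone (fun t => N t ω) ∧
    ∀ t, ContinuousWithinAt (fun s => N s ω) (Set.Ici t) t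
  indep_increments : HasIndepIncrements N P
  law_increments : ∀ s t, s ≤ t →
    P.map (fun ω => N t ω - N s ω) = poissonMeasure (t - s)

/-- The parameters of the service system that do not depend on the scaling parameter: the allowed
activities `E` (pairs of a customer type and a server type), the arrival rates `lam`, the pool size
parameters `beta` and the service rates `mu`, which matter for allowed activities only. -/
structure Network (I J : Type*) where
  E : Finset (I × J)
  lam : I → ℝ
  beta : J → ℝ
  mu : I → J → ℝ
  lam_pos : ∀ i, 0 < lam i
  beta_pos : ∀ j, 0 < beta j
  mu_pos : ∀ e ∈ E, 0 < mu e.1 e.2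

/-- A state of the (unscaled) system: `queue i` is the number of waiting customers of type `i`, and
`busy i j` is the number of servers of type `j` that are serving a customer of type `i`. -/
structure State (I J : Type*) where
  queue : I → ℕ
  busy : I → J → ℕ

section

variable {I J : Type*} [Fintype I] [DecidableEq I] [Fintype J] [DecidableEq J]

/-- `S(i)`: the server types that can serve customers of type `i`. -/
def Network.S (net : Network I J) (i : I) : Finset J := {j | (i, j) ∈ net.E}

/-- `C(j)`: the customer types that can be served by servers of type `j`. -/
def Network.C (net : Network I J) (j : J) : Finset I := {i | (i, j) ∈ net.E}

namespace State

/-- The number of busy servers of type `j`. -/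
def poolBusy (net : Network I J) (z : State I J) (j : J) : ℕ := ∑ i ∈ net.C j, z.busy i j

/-- The instantaneous load `Ξ_j = Ψ_j / β_j` of pool `j`. -/
noncomputable def load (net : Network I J) (z : State I J) (j : J) : ℝ :=
  (z.poolBusy net j : ℝ) / net.beta j

/-- The total number of customers of type `i` in the system. -/
def total (net : Network I J) (z : State I J) (i : I) : ℕ :=
  z.queue i + ∑ j ∈ net.S i, z.busy i j

/-- The states in which the system can be, when pool `j` has `size j` servers: no server works on
an activity that is not allowed, no pool has more busy servers than servers, and no server idles
while a customer that it can serve is waiting. -/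
structure Feasible (net : Network I J) (size : J → ℕ) (z : State I J) : Prop where
  allowed : ∀ i j, (i, j) ∉ net.E → z.busy i j = 0
  capacity : ∀ j, z.poolBusy net j ≤ size j
  nonidling : ∀ i, 0 < z.queue i → ∀ j ∈ net.S i, z.poolBusy net j = size j

/-- Routing. A customer of type `i` arrives when the state is `z` and takes it to `z'`. If some pool
in `S(i)` has an unoccupied server, then the customer is taken into service in a least loaded pool
in `S(i)` (ties are broken arbitrarily); otherwise it joins the queue of its type. -/
def ArrivalStep (net : Network I J) (size : J → ℕ) (i : I) (z z' : State I J) : Prop :=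
  ((∃ j ∈ net.S i, z.poolBusy net j < size j) ∧
    ∃ j ∈ net.S i, (∀ j' ∈ net.S i, z.load net j ≤ z.load net j') ∧
      z'.queue = z.queue ∧
      ∀ a b, z'.busy a b = z.busy a b + if a = i ∧ b = j then 1 else 0) ∨
  ((∀ j ∈ net.S i, size j ≤ z.poolBusy net j) ∧
    z'.busy = z.busy ∧ ∀ a, z'.queue a = z.queue a + if a = i then 1 else 0)

/-- Scheduling. A server of type `j` completes the service of a customer of type `i` when the state
is `z`, which becomes `z'`. If a customer of a type in `C(j)` is waiting, then the server takes a
customer from a longest queue among those of the types in `C(j)` (ties are broken arbitrarily);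
otherwise it becomes idle. -/
def ServiceStep (net : Network I J) (i : I) (j : J) (z z' : State I J) : Prop :=
  ((∃ k ∈ net.C j, 0 < z.queue k) ∧
    ∃ k ∈ net.C j, (∀ k' ∈ net.C j, z.queue k' ≤ z.queue k) ∧
      (∀ a, z'.queue a + (if a = k then 1 else 0) = z.queue a) ∧
      ∀ a b, z'.busy a b + (if a = i ∧ b = j then 1 else 0) =
        z.busy a b + if a = k ∧ b = j then 1 else 0) ∨
  ((∀ k ∈ net.C j, z.queue k = 0) ∧
    z'.queue = z.queue ∧
    ∀ a b, z'.busy a b + (if a = i ∧ b = j then 1 else 0) = z.busy a b)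

end State

/-- `departures net r S Z e t`: the number of completed services by time `t` along the activity
`e = (i, j)`, i.e. the number `S e u` of completions after a total time `r * u = ∫₀ᵗ Ψ_ij(s) ds` has
been spent on these services. -/
noncomputable def departures (net : Network I J) (r : ℝ) (S : net.E → ℝ → ℕ) (Z : ℝ → State I J)
    (e : net.E) (t : ℝ) : ℕ :=
  S e (r⁻¹ * ∫ s in (0 : ℝ)..t, ((Z s).busy e.1.1 e.1.2 : ℝ))

/-- `Z` is a trajectory on `[0, ∞)` of the LQFS-LB system with scaling parameter `r` and pool sizes
`size`, driven by the arrival counts `A` and the service counts `S`: it starts in a feasible state,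
it is right-continuous and piecewise constant, and it changes only at arrivals and at service
completions, one at a time and according to the routing and the scheduling rule. Paths with two
events at the same time (which have probability zero for independent Poisson drivers) are not
considered. -/
structure IsLQFSPath (net : Network I J) (r : ℝ) (size : J → ℕ)
    (A : I → ℝ → ℕ) (S : net.E → ℝ → ℕ) (Z : ℝ → State I J) : Prop where
  initial : (Z 0).Feasible net size
  right_cont : ∀ t, 0 ≤ t → ∀ᶠ s in 𝓝[>] t, Z s = Z t
  jump : ∀ t, 0 < t → ∀ᶠ s in 𝓝[<] t,
    ((∀ i, A i t = A i s) ∧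
      (∀ e, departures net r S Z e t = departures net r S Z e s) ∧ Z t = Z s) ∨
    (∃ i, (∀ i', A i' t = A i' s + if i' = i then 1 else 0) ∧
      (∀ e, departures net r S Z e t = departures net r S Z e s) ∧
      State.ArrivalStep net size i (Z s) (Z t)) ∨
    (∃ e : net.E, (∀ i, A i t = A i s) ∧
      (∀ e', departures net r S Z e' t = departures net r S Z e' s + if e' = e then 1 else 0) ∧
      State.ServiceStep net e.1.1 e.1.2 (Z s) (Z t))

/-- `(a, x, q, psi, rho)` is a fluid model: all the components (those of `psi` being indexed by the
allowed activities) are Lipschitz continuous on `[0, ∞)` and satisfy the fluid model equations. The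
two equations with derivatives are required at each `t ≥ 0` at which the derivatives of the `psi i j`
that occur in them exist (at `t = 0`, the right derivatives). -/
structure IsFluidModel (net : Network I J) (a x q : I → ℝ → ℝ) (psi : I → J → ℝ → ℝ)
    (rho : J → ℝ → ℝ) : Prop where
  lipschitz_a : ∀ i, ∃ K, LipschitzOnWith K (a i) (Set.Ici 0)
  lipschitz_x : ∀ i, ∃ K, LipschitzOnWith K (x i) (Set.Ici 0)
  lipschitz_q : ∀ i, ∃ K, LipschitzOnWith K (q i) (Set.Ici 0)
  lipschitz_psi : ∀ i, ∀ j ∈ net.S i, ∃ K, LipschitzOnWith K (psi i j) (Set.Ici 0)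
  lipschitz_rho : ∀ j, ∃ K, LipschitzOnWith K (rho j) (Set.Ici 0)
  arrivals : ∀ i, ∀ t, 0 ≤ t → a i t = net.lam i * t
  total : ∀ i, ∀ t, 0 ≤ t → x i t = q i t + ∑ j ∈ net.S i, psi i j t
  balance : ∀ i, ∀ t, 0 ≤ t →
    x i t = x i 0 + a i t - ∑ j ∈ net.S i, ∫ s in (0 : ℝ)..t, net.mu i j * psi i j s
  load : ∀ j, ∀ t, 0 ≤ t → rho j t = 1 / net.beta j * ∑ i ∈ net.C j, psi i j t
  work_conservation : ∀ j, ∀ t, 0 ≤ t → (∃ i ∈ net.C j, 0 < q i t) → rho j t = 1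
  longest_queue : ∀ (Is : Finset I) (Js : Finset J) (t : ℝ), 0 ≤ t →
    (∀ i ∈ Is, 0 < q i t) →
    (∀ i ∈ Is, ∀ i' ∉ Is, (net.S i ∩ net.S i' ∩ Js).Nonempty → q i' t < q i t) →
    ∀ dpsi : I → J → ℝ,
      (∀ i ∈ Is, ∀ j ∈ net.S i ∩ Js, HasDerivWithinAt (psi i j) (dpsi i j) (Set.Ici 0) t) →
      ∑ i ∈ Is, ∑ j ∈ net.S i ∩ Js, dpsi i j =
        (∑ j ∈ Is.biUnion (fun i => net.S i ∩ Js), ∑ i' ∈ net.C j, net.mu i' j * psi i' j t) -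
          ∑ i ∈ Is, ∑ j ∈ net.S i ∩ Js, net.mu i j * psi i j t
  freest_server : ∀ (Is : Finset I) (Js : Finset J) (t : ℝ), 0 ≤ t →
    (∀ j ∈ Js, rho j t < 1) →
    (∀ j ∈ Js, ∀ j' ∉ Js, (net.C j ∩ net.C j' ∩ Is).Nonempty → rho j t < rho j' t) →
    ∀ dpsi : I → J → ℝ,
      (∀ j ∈ Js, ∀ i ∈ net.C j ∩ Is, HasDerivWithinAt (psi i j) (dpsi i j) (Set.Ici 0) t) →
      ∑ j ∈ Js, ∑ i ∈ net.C j ∩ Is, dpsi i j =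
        (∑ i ∈ Js.biUnion (fun j => net.C j ∩ Is), net.lam i) -
          ∑ j ∈ Js, ∑ i ∈ net.C j ∩ Is, net.mu i j * psi i j t

/-- Uniform convergence on compact subsets of `[0, ∞)` of a sequence of functions. -/
def TendstoUOC (f : ℕ → ℝ → ℝ) (g : ℝ → ℝ) : Prop :=
  ∀ T : ℝ, TendstoUniformlyOn f g atTop (Set.Icc 0 T)

end

end LQFS

namespace LQFS

/-! ### Uniform convergence on compact sets -/

/-! The argument is pathwise: probability enters only through the strong law of large numbers for
the unit Poisson drivers. Unit increments of a driver are i.i.d. Poisson with mean one, and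
monotonicity upgrades the law along the integers to uniform convergence of the scaled drivers on
compact sets (`tendstoUOC_scaled_counting`). From then on a sample path is fixed.

Compactness. Pool `j` has `r β_j` servers, so the scaled service time of an activity is
`β_j`-Lipschitz, and its scaled completions are close to `μ_ij` times that time. Hence the scaled
number of all events is Lipschitz up to a vanishing error. One event changes each queue and each
busy count by at most one, so all of these inherit the bound, and an Arzelà–Ascoli argument
(`exists_subseq_tendstoUOC`) gives a subsequence with Lipschitz limits.

Fluid equations. Each comes from a quantity that no transition of the system changes, or from
feasibility of the states. The balance equation comes from counting customers. For equation 6, as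
long as the queues in `Is` are positive and strictly longer than their competitors, every completion
in a pool that serves `Is` within `Js` starts a service of a type in `Is`, while arrivals of these
types only queue (`Config.Transition.longest_queue`). For equation 7, as long as the pools in `Js`
have free servers and are strictly less loaded than their competitors, exactly the arrivals of the
relevant types enter `Js`, and no freed server there is reassigned
(`Config.Transition.freest_server`). Strict inequalities between the continuous limits at time `t`
persist for all large `n` on a common interval `[t, b]`. The resulting identities for increments
pass to the limit and are differentiated from the right at `t`, which also covers `t = 0`. -/

theorem tendstoUOC_iff {f : ℕ → ℝ → ℝ} {g : ℝ → ℝ} :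
    TendstoUOC f g ↔ ∀ T, 0 ≤ T → ∀ ε > 0, ∀ᶠ n in atTop, ∀ t ∈ Set.Icc 0 T, |f n t - g t| < ε := by
  constructor
  · intro h T _ ε hε
    filter_upwards [Metric.tendstoUniformlyOn_iff.1 (h T) ε hε] with n hn t ht
    rw [abs_sub_comm]
    exact hn t ht
  · intro h T
    rcases lt_or_ge T 0 with hT | hT
    · rw [Set.Icc_eq_empty (not_le.2 hT)]
      exact tendstoUniformlyOn_empty
    · refine Metric.tendstoUniformlyOn_iff.2 fun ε hε => ?_
      filter_upwards [h T hT ε hε] with n hn t ht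
      rw [dist_comm]
      exact hn t ht

/-! ### The law of large numbers for a Poisson process -/

/-- The factor `n` cancels against the factorial, so the terms are `r` times the Poisson weights
shifted by one index. -/
theorem hasSum_mul_poisson (r : ℝ≥0) :
    HasSum (fun n : ℕ => Real.exp (-r) * (r : ℝ) ^ n / n.factorial * n) r := by
  have h := (hasSum_one_poissonMeasure r).mul_left (r : ℝ)
  rw [mul_one] at h
  refine (hasSum_nat_add_iff' 1).1 ?_
  simp only [Finset.range_one, Finset.sum_singleton, Nat.cast_zero, mul_zero, sub_zero]
  refine h.congr_fun fun n => ?_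
  rw [Nat.factorial_succ]
  push_cast
  field_simp
  ring

theorem integrable_cast_poissonMeasure (r : ℝ≥0) :
    Integrable (fun n : ℕ => (n : ℝ)) (poissonMeasure r) := by
  rw [integrable_poissonMeasure_iff]
  simpa using (hasSum_mul_poisson r).summable

theorem integral_cast_poissonMeasure (r : ℝ≥0) :
    ∫ n : ℕ, (n : ℝ) ∂(poissonMeasure r) = r := by
  rw [integral_poissonMeasure]
  simpa using (hasSum_mul_poisson r).tsum_eq

/-- The increments over `(k, k + 1]` are independent Poisson variables with mean one, and they
telescope to the value at `n`, so the strong law applies. -/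
theorem IsUnitPoissonProcess.ae_tendsto_nat {Ω : Type*} [MeasurableSpace Ω] {P : Measure Ω}
    [IsProbabilityMeasure P] {N : ℝ≥0 → Ω → ℕ} (hN : IsUnitPoissonProcess P N) :
    ∀ᵐ ω ∂P, Tendsto (fun n : ℕ => (N n ω : ℝ) / n) atTop (𝓝 1) := by
  set D : ℕ → Ω → ℕ := fun k ω => N (k + 1 : ℕ) ω - N k ω with hD
  have hDm : ∀ k, Measurable (D k) := fun k => (hN.measurable _).sub (hN.measurable _)
  have hlaw : ∀ k, P.map (D k) = poissonMeasure 1 := by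
    intro k
    have := hN.law_increments (k : ℝ≥0) (k + 1 : ℕ) (by simp)
    rw [this]
    congr 1
    simp
  have hcast : Measurable (fun n : ℕ => (n : ℝ)) := measurable_from_top
  have hind : iIndepFun D P := by
    have := hN.indep_increments.nat (t := fun k : ℕ => (k : ℝ≥0)) Nat.mono_cast
    exact this
  have hint : Integrable (fun ω => (D 0 ω : ℝ)) P := by
    have h := integrable_cast_poissonMeasure 1
    rw [← hlaw 0] at h
    exact h.comp_measurable (hDm 0)
  have hmean : ∫ ω, (D 0 ω : ℝ) ∂P = 1 := by
    have h := integral_cast_poissonMeasure 1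
    rw [← hlaw 0, integral_map (hDm 0).aemeasurable hcast.aestronglyMeasurable] at h
    simpa using h
  have key := strong_law_ae_real (μ := P) (fun k ω => (D k ω : ℝ)) hint
    (fun i j hij => (hind.indepFun hij).comp hcast hcast)
    (fun i => ((⟨(hDm i).aemeasurable, (hDm 0).aemeasurable, by rw [hlaw, hlaw]⟩ :
      IdentDistrib (D i) (D 0) P P)).comp hcast)
  filter_upwards [key, hN.paths] with ω hω hp
  rw [hmean] at hω
  refine hω.congr fun n => ?_
  congr 1
  -- Subtraction in `ℕ` is truncated; monotone paths make it a true difference, so that the sum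
  -- telescopes.
  have hmono : ∀ k : ℕ, N k ω ≤ N (k + 1 : ℕ) ω := fun k => hp.2.1 (by simp)
  have : ∀ k : ℕ, (D k ω : ℝ) = (N (k + 1 : ℕ) ω : ℝ) - N k ω := fun k => by
    rw [hD, Nat.cast_sub (hmono k)]
  simp_rw [this]
  rw [Finset.sum_range_sub (fun k : ℕ => (N k ω : ℝ))]
  simp [hp.1]

/-- The error has this affine form because it behaves well under scaling: after division by `r` the
constant disappears and the slope `ε` remains. -/
theorem abs_sub_le_of_tendsto_div {N : ℝ≥0 → ℕ} (hN : Monotone N)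
    (hlim : Tendsto (fun n : ℕ => (N n : ℝ) / n) atTop (𝓝 1)) {ε : ℝ} (hε : 0 < ε) :
    ∃ C, 0 ≤ C ∧ ∀ u : ℝ≥0, |(N u : ℝ) - u| ≤ ε * u + C := by
  obtain ⟨M, hM⟩ := eventually_atTop.1 (Metric.tendsto_nhds.1 hlim ε hε)
  have hM' : ∀ n ≥ max M 1, |(N n : ℝ) - n| ≤ ε * n := by
    intro n hn
    have hn0 : (0 : ℝ) < n := by exact_mod_cast (le_of_max_le_right hn)
    have h := (hM n (le_of_max_le_left hn)).le
    rw [Real.dist_eq, div_sub_one hn0.ne', abs_div, abs_of_pos hn0, div_le_iff₀ hn0] at h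
    exact h
  set K := max M 1
  -- `N K + K` covers `u ≤ K` crudely; `1 + ε` pays for replacing `u` by a neighbouring integer
  -- beyond `K`.
  refine ⟨N K + K + 1 + ε, by positivity, fun u => ?_⟩
  have hu : (0 : ℝ) ≤ u := u.2
  have h1 : ((⌊u⌋₊ : ℝ≥0)) ≤ u := Nat.floor_le u.2
  have h2 : u ≤ ((⌊u⌋₊ + 1 : ℕ) : ℝ≥0) := by push_cast; exact (Nat.lt_floor_add_one u).le
  have h1' : (⌊u⌋₊ : ℝ) ≤ u := by exact_mod_cast h1
  have h2' : (u : ℝ) ≤ (⌊u⌋₊ : ℝ) + 1 := by exact_mod_cast h2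
  have n1 : (N (⌊u⌋₊ : ℝ≥0) : ℝ) ≤ N u := by exact_mod_cast hN h1
  have n2 : (N u : ℝ) ≤ N ((⌊u⌋₊ + 1 : ℕ) : ℝ≥0) := by exact_mod_cast hN h2
  have hNK : (0 : ℝ) ≤ N K := Nat.cast_nonneg _
  have hK : (0 : ℝ) ≤ K := Nat.cast_nonneg _
  rcases le_or_gt K ⌊u⌋₊ with h | h
  · have e1 := abs_le.1 (hM' _ h)
    have e2 := abs_le.1 (hM' (⌊u⌋₊ + 1) (by omega))
    push_cast at e2 n2
    rw [abs_le]
    constructor <;> nlinarith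
  · have hK1 : (⌊u⌋₊ : ℝ) + 1 ≤ K := by exact_mod_cast h
    have hKu : u ≤ K := h2.trans (by exact_mod_cast h)
    have n3 : (N u : ℝ) ≤ N K := by exact_mod_cast hN hKu
    have n4 : (0 : ℝ) ≤ N u := Nat.cast_nonneg _
    have := mul_nonneg hε.le hu
    rw [abs_le]
    constructor <;> linarith

theorem tendstoUOC_scaled_counting {N : ℝ≥0 → ℕ} (hN : Monotone N)
    (hlim : Tendsto (fun n : ℕ => (N n : ℝ) / n) atTop (𝓝 1)) {r c : ℕ → ℝ} {l : ℝ}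
    (hr_pos : ∀ n, 0 < r n) (hr : Tendsto r atTop atTop) (hc : ∀ n, 0 ≤ c n)
    (hcl : Tendsto (fun n => c n / r n) atTop (𝓝 l)) :
    TendstoUOC (fun n t => (N (c n * t).toNNReal : ℝ) / r n) (fun t => l * t) := by
  rw [tendstoUOC_iff]
  intro T hT ε hε
  have hl : 0 ≤ l := ge_of_tendsto' hcl fun n => div_nonneg (hc n) (hr_pos n).le
  -- The error bound tends to `δ * l * T`, which this choice keeps below `ε`, also when `l` or `T`
  -- vanishes.
  set δ : ℝ := ε / (2 * ((l + 1) * T + 1)) with hδ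
  have hδ0 : 0 < δ := by positivity
  obtain ⟨C, hC0, hC⟩ := abs_sub_le_of_tendsto_div hN hlim hδ0
  have hd : Tendsto (fun n => δ * (c n / r n) * T + C / r n + |c n / r n - l| * T) atTop
      (𝓝 (δ * l * T + 0 + |l - l| * T)) :=
    (((hcl.const_mul δ).mul_const T).add (hr.const_div_atTop C)).add
      ((hcl.sub_const l).abs.mul_const T)
  have hlt : δ * l * T + 0 + |l - l| * T < ε := by
    have : δ * (2 * ((l + 1) * T + 1)) = ε := by rw [hδ]; field_simp
    simp only [sub_self, abs_zero, zero_mul, add_zero]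
    nlinarith [mul_nonneg hδ0.le hT, mul_nonneg (mul_nonneg hδ0.le hT) hl]
  filter_upwards [hd.eventually_lt_const hlt] with n hn t ht
  have hrn := hr_pos n
  have hct : 0 ≤ c n * t := mul_nonneg (hc n) ht.1
  have h1 := hC (c n * t).toNNReal
  rw [Real.coe_toNNReal _ hct] at h1
  have hcr : 0 ≤ c n / r n := div_nonneg (hc n) hrn.le
  calc |(N (c n * t).toNNReal : ℝ) / r n - l * t|
      = |((N (c n * t).toNNReal : ℝ) - c n * t) / r n + (c n / r n - l) * t| := by
        congr 1; field_simp; ring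
    _ ≤ |((N (c n * t).toNNReal : ℝ) - c n * t) / r n| + |(c n / r n - l) * t| := abs_add_le _ _
    _ ≤ (δ * (c n * t) + C) / r n + |c n / r n - l| * t := by
        rw [abs_div, abs_of_pos hrn, abs_mul, abs_of_nonneg ht.1]
        gcongr
    _ = δ * (c n / r n) * t + C / r n + |c n / r n - l| * t := by ring
    _ ≤ δ * (c n / r n) * T + C / r n + |c n / r n - l| * T := by
        have := ht.2
        gcongr
    _ < ε := hn

/-! ### Compactness of asymptotically Lipschitz sequences -/

/-- On compact sets, the oscillation of `f n` is bounded by that of a `K`-Lipschitz function up to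
an error that vanishes as `n → ∞`. -/
def IsAsymptoticallyLipschitz (K : ℝ≥0) (f : ℕ → ℝ → ℝ) : Prop :=
  ∀ T, 0 ≤ T → ∀ ε > 0, ∀ᶠ n in atTop, ∀ s ∈ Set.Icc 0 T, ∀ t ∈ Set.Icc 0 T,
    |f n t - f n s| ≤ K * |t - s| + ε

namespace IsAsymptoticallyLipschitz

variable {K K' : ℝ≥0} {f g : ℕ → ℝ → ℝ}

theorem add (hf : IsAsymptoticallyLipschitz K f) (hg : IsAsymptoticallyLipschitz K' g) :
    IsAsymptoticallyLipschitz (K + K') (fun n t => f n t + g n t) := by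
  intro T hT ε hε
  filter_upwards [hf T hT (ε / 2) (by positivity), hg T hT (ε / 2) (by positivity)]
    with n h1 h2 s hs t ht
  rw [add_sub_add_comm]
  refine (abs_add_le _ _).trans ?_
  have h3 := h1 s hs t ht
  have h4 := h2 s hs t ht
  push_cast
  linarith

theorem sum {ι : Type*} {F : ι → ℕ → ℝ → ℝ} {C : ι → ℝ≥0} (u : Finset ι)
    (hF : ∀ i ∈ u, IsAsymptoticallyLipschitz (C i) (F i)) :
    IsAsymptoticallyLipschitz (∑ i ∈ u, C i) (fun n t => ∑ i ∈ u, F i n t) := by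
  classical
  induction u using Finset.induction_on with
  | empty =>
    intro T _ ε hε
    exact Eventually.of_forall fun n s _ t _ => by simpa using hε.le
  | insert i u hi ih =>
    simp only [Finset.sum_insert hi]
    exact (hF i (Finset.mem_insert_self i u)).add
      (ih fun k hk => hF k (Finset.mem_insert_of_mem hk))

theorem of_approx (hg : ∀ n, ∀ s, 0 ≤ s → ∀ t, s ≤ t → |g n t - g n s| ≤ K * (t - s))
    (hfg : TendstoUOC (fun n t => f n t - g n t) (fun _ => 0)) :
    IsAsymptoticallyLipschitz K f := by
  intro T hT ε hε
  filter_upwards [tendstoUOC_iff.1 hfg T hT (ε / 2) (by positivity)] with n hn s hs t ht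
  have h1 := abs_lt.1 (hn s hs)
  have h2 := abs_lt.1 (hn t ht)
  have h3 : |g n t - g n s| ≤ K * |t - s| := by
    rcases le_total s t with h | h
    · rw [abs_of_nonneg (sub_nonneg.2 h)]
      exact hg n s hs.1 t h
    · rw [abs_sub_comm, abs_sub_comm t s, abs_of_nonneg (sub_nonneg.2 h)]
      exact hg n t ht.1 s h
  have h4 := abs_le.1 h3
  rw [abs_le]
  constructor <;> linarith

/-- This passes the bound for the total number of events on to every component of the state. -/
theorem mono (hg : IsAsymptoticallyLipschitz K g)
    (hfg : ∀ n, ∀ s, 0 ≤ s → ∀ t, s ≤ t → |f n t - f n s| ≤ g n t - g n s) :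
    IsAsymptoticallyLipschitz K f := by
  intro T hT ε hε
  filter_upwards [hg T hT ε hε] with n hn s hs t ht
  rcases le_total s t with h | h
  · exact ((hfg n s hs.1 t h).trans (le_abs_self _)).trans (hn s hs t ht)
  · rw [abs_sub_comm, abs_sub_comm t s]
    exact ((hfg n t ht.1 s h).trans (le_abs_self _)).trans (hn t ht s hs)

theorem comp_tendsto (hf : IsAsymptoticallyLipschitz K f) {θ : ℕ → ℕ}
    (hθ : Tendsto θ atTop atTop) : IsAsymptoticallyLipschitz K (fun n => f (θ n)) :=
  fun T hT ε hε => hθ.eventually (hf T hT ε hε)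

theorem lipschitzOnWith_of_tendsto (hf : IsAsymptoticallyLipschitz K f) {l : ℝ → ℝ}
    (hl : ∀ t, 0 ≤ t → Tendsto (fun n => f n t) atTop (𝓝 (l t))) :
    LipschitzOnWith K l (Set.Ici 0) := by
  refine LipschitzOnWith.of_dist_le_mul fun s hs t ht => ?_
  have hs' : (0 : ℝ) ≤ s := hs
  have ht' : (0 : ℝ) ≤ t := ht
  refine le_of_forall_pos_le_add fun ε hε => ?_
  refine le_of_tendsto ((hl s hs).sub (hl t ht)).abs ?_
  filter_upwards [hf (max s t) (hs'.trans (le_max_left _ _)) ε hε] with n hn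
  exact hn t ⟨ht', le_max_right _ _⟩ s ⟨hs', le_max_left _ _⟩

/-- Equicontinuity up to a vanishing error makes pointwise convergence locally uniform, and
compactness does the rest. Near `x` four errors of size `ε / 4` add up: pointwise convergence at
`x`, the vanishing error, and the Lipschitz terms of `f n` and of `l`. -/
theorem tendstoUOC (hf : IsAsymptoticallyLipschitz K f) {l : ℝ → ℝ}
    (hfl : ∀ t, 0 ≤ t → Tendsto (fun n => f n t) atTop (𝓝 (l t))) : TendstoUOC f l := by
  have hl := hf.lipschitzOnWith_of_tendsto hfl
  intro T
  rw [← tendstoLocallyUniformlyOn_iff_tendstoUniformlyOn_of_compact isCompact_Icc,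
    Metric.tendstoLocallyUniformlyOn_iff]
  intro ε hε x hx
  have hT : 0 ≤ T := hx.1.trans hx.2
  set δ : ℝ := ε / (4 * (K + 1)) with hδ
  have hK : (0 : ℝ) ≤ K := K.2
  have hδ0 : 0 < δ := by positivity
  have hKδ : K * δ ≤ ε / 4 := by
    rw [hδ, mul_div_assoc', div_le_div_iff₀ (by positivity) (by norm_num)]
    nlinarith
  refine ⟨Metric.ball x δ ∩ Set.Icc 0 T,
    inter_mem (mem_nhdsWithin_of_mem_nhds (Metric.ball_mem_nhds x hδ0)) self_mem_nhdsWithin, ?_⟩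
  filter_upwards [Metric.tendsto_nhds.1 (hfl x hx.1) (ε / 4) (by positivity),
    hf T hT (ε / 4) (by positivity)] with n h1 h2 y hy
  have hyx : |y - x| < δ := by simpa [Real.dist_eq] using hy.1
  have h3 := h2 x hx y hy.2
  have h4 := hl.dist_le_mul y hy.2.1 x hx.1
  rw [Real.dist_eq] at h1 h4 ⊢
  rw [Real.dist_eq] at h4
  have h5 : K * |y - x| ≤ ε / 4 := (mul_le_mul_of_nonneg_left hyx.le hK).trans hKδ
  rw [abs_lt] at h1 ⊢
  have h3' := abs_le.1 h3
  have h4' := abs_le.1 h4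
  constructor <;> linarith

/-- The values at `t` form a Cauchy sequence by comparison with a rational point slightly to the
right of `t`. -/
theorem exists_tendsto (hf : IsAsymptoticallyLipschitz K f) {G : ℚ≥0 → ℝ}
    (hG : ∀ q : ℚ≥0, Tendsto (fun n => f n (q : ℝ)) atTop (𝓝 (G q))) {t : ℝ} (ht : 0 ≤ t) :
    ∃ l, Tendsto (fun n => f n t) atTop (𝓝 l) := by
  refine cauchySeq_tendsto_of_complete (Metric.cauchySeq_iff'.2 fun ε hε => ?_)
  set δ : ℝ := min 1 (ε / (8 * (K + 1))) with hδ
  have hK : (0 : ℝ) ≤ K := K.2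
  have hδ0 : 0 < δ := by positivity
  have hKδ : K * δ ≤ ε / 8 := by
    refine (mul_le_mul_of_nonneg_left (min_le_right _ _) hK).trans ?_
    rw [mul_div_assoc', div_le_div_iff₀ (by positivity) (by norm_num)]
    nlinarith
  obtain ⟨q, hq1, hq2⟩ := exists_rat_btwn (show t < t + δ by linarith)
  have hq0 : (0 : ℚ) ≤ q := by exact_mod_cast ht.trans hq1.le
  lift q to ℚ≥0 using hq0
  have hq1' : t < (q : ℝ) := by exact_mod_cast hq1
  have hq2' : (q : ℝ) < t + δ := by exact_mod_cast hq2
  have hδ1 : δ ≤ 1 := min_le_left _ _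
  obtain ⟨M, hM⟩ := eventually_atTop.1 ((Metric.tendsto_nhds.1 (hG q) (ε / 8) (by positivity)).and
    (hf (t + 1) (by linarith) (ε / 8) (by positivity)))
  have hclose : ∀ n ≥ M, |f n t - G q| < 3 * (ε / 8) + ε / 8 := by
    intro n hn
    obtain ⟨h1, h2⟩ := hM n hn
    have h3 := h2 t ⟨ht, by linarith⟩ q ⟨by linarith, by linarith⟩
    rw [abs_of_pos (show (0 : ℝ) < q - t by linarith)] at h3
    have h4 : K * ((q : ℝ) - t) ≤ ε / 8 :=
      (mul_le_mul_of_nonneg_left (by linarith) hK).trans hKδ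
    have h5 := abs_le.1 h3
    rw [Real.dist_eq] at h1
    have h6 := abs_lt.1 h1
    rw [abs_lt]
    constructor <;> linarith
  refine ⟨M, fun n hn => ?_⟩
  rw [Real.dist_eq]
  have a1 := abs_lt.1 (hclose n hn)
  have a2 := abs_lt.1 (hclose M le_rfl)
  rw [abs_lt]
  constructor <;> linarith

/-- An Arzelà–Ascoli theorem for functions that need not be continuous. Compactness of a countable
product of intervals replaces the diagonal extraction at rational times. -/
theorem exists_subseq_tendstoUOC {κ : Type*} [Countable κ] {F : κ → ℕ → ℝ → ℝ}
    (hF : ∀ k, IsAsymptoticallyLipschitz K (F k))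
    (hF0 : ∀ k, ∃ B, ∀ᶠ n in atTop, |F k n 0| ≤ B) :
    ∃ (θ : ℕ → ℕ) (l : κ → ℝ → ℝ), StrictMono θ ∧ ∀ k,
      LipschitzOnWith K (l k) (Set.Ici 0) ∧ TendstoUOC (fun n => F k (θ n)) (l k) := by
  have hbound : ∀ p : κ × ℚ≥0, ∃ B, 0 ≤ B ∧ ∀ᶠ n in atTop, |F p.1 n (p.2 : ℝ)| ≤ B := by
    rintro ⟨k, q⟩
    obtain ⟨B, hB⟩ := hF0 k
    have hq : (0 : ℝ) ≤ (q : ℝ) := by positivity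
    refine ⟨|B + K * q + 1|, abs_nonneg _, ?_⟩
    filter_upwards [hB, hF k q hq 1 one_pos] with n h3 h2
    have h1 := h2 0 ⟨le_rfl, hq⟩ q ⟨hq, le_rfl⟩
    rw [sub_zero, abs_of_nonneg hq] at h1
    have h3 := abs_le.1 h3
    have h4 := abs_le.1 h1
    refine le_trans ?_ (le_abs_self _)
    rw [abs_le]
    constructor <;> linarith
  choose B hB0 hB using hbound
  obtain ⟨G, -, θ, hθ, hG⟩ := (isCompact_univ_pi fun p : κ × ℚ≥0 =>
    isCompact_Icc (a := -B p) (b := B p)).tendsto_subseq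
      -- The bounds hold only for large `n`, so the values are truncated; at each point the
      -- truncation is eventually inactive.
      (x := fun n p => max (-B p) (min (B p) (F p.1 n (p.2 : ℝ)))) fun n p _ =>
        ⟨le_max_left _ _, max_le (by linarith [hB0 p]) (min_le_left _ _)⟩
  rw [tendsto_pi_nhds] at hG
  have hθt := hθ.tendsto_atTop
  have hG' : ∀ k (q : ℚ≥0), Tendsto (fun n => F k (θ n) (q : ℝ)) atTop (𝓝 (G (k, q))) := by
    intro k q
    refine (hG (k, q)).congr' ?_
    filter_upwards [hθt.eventually (hB (k, q))] with n hn
    have := abs_le.1 hn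
    simp only [Function.comp]
    rw [min_eq_right this.2, max_eq_right this.1]
  have hex : ∀ k t, 0 ≤ t → ∃ l, Tendsto (fun n => F k (θ n) t) atTop (𝓝 l) := fun k t ht =>
    ((hF k).comp_tendsto hθt).exists_tendsto (hG' k) ht
  choose! l hl using hex
  exact ⟨θ, l, hθ, fun k => ⟨((hF k).comp_tendsto hθt).lipschitzOnWith_of_tendsto (hl k),
    ((hF k).comp_tendsto hθt).tendstoUOC (hl k)⟩⟩

end IsAsymptoticallyLipschitz

/-! ### Consequences of uniform convergence on compact sets -/

namespace TendstoUOC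

variable {f f' : ℕ → ℝ → ℝ} {g g' : ℝ → ℝ}

theorem tendsto (h : TendstoUOC f g) {t : ℝ} (ht : 0 ≤ t) :
    Tendsto (fun n => f n t) atTop (𝓝 (g t)) :=
  (h t).tendsto_at ⟨ht, le_rfl⟩

theorem comp_tendsto (h : TendstoUOC f g) {θ : ℕ → ℕ} (hθ : Tendsto θ atTop atTop) :
    TendstoUOC (fun n => f (θ n)) g := fun T u hu => hθ.eventually (h T u hu)

theorem add (h : TendstoUOC f g) (h' : TendstoUOC f' g') :
    TendstoUOC (fun n t => f n t + f' n t) (fun t => g t + g' t) :=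
  fun T => (h T).add (h' T)

theorem sum {ι : Type*} {F : ι → ℕ → ℝ → ℝ} {G : ι → ℝ → ℝ} (u : Finset ι)
    (h : ∀ i ∈ u, TendstoUOC (F i) (G i)) :
    TendstoUOC (fun n t => ∑ i ∈ u, F i n t) (fun t => ∑ i ∈ u, G i t) := by
  classical
  induction u using Finset.induction_on with
  | empty =>
    refine tendstoUOC_iff.2 fun T _ ε hε => Eventually.of_forall fun n t _ => ?_
    simpa using hε
  | insert i u hi ih =>
    simp only [Finset.sum_insert hi]
    exact (h i (Finset.mem_insert_self i u)).add (ih fun k hk => h k (Finset.mem_insert_of_mem hk))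

theorem const_mul (h : TendstoUOC f g) (c : ℝ) :
    TendstoUOC (fun n t => c * f n t) (fun t => c * g t) := by
  refine tendstoUOC_iff.2 fun T hT ε hε => ?_
  filter_upwards [tendstoUOC_iff.1 h T hT (ε / (|c| + 1)) (by positivity)] with n hn t ht
  rw [← mul_sub, abs_mul]
  have h1 := hn t ht
  rw [lt_div_iff₀ (by positivity)] at h1
  nlinarith [abs_nonneg (f n t - g t), abs_nonneg c]

/-- Joint convergence in the index and the time is what lets a strict inequality at `t` hold for all
large `n` and all times slightly after `t` at once. -/
theorem tendsto_prod (h : TendstoUOC f g) (hg : ContinuousOn g (Set.Ici 0)) {t : ℝ} (ht : 0 ≤ t) :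
    Tendsto (fun p : ℕ × ℝ => f p.1 p.2) (atTop ×ˢ 𝓝[≥] t) (𝓝 (g t)) := by
  rw [Metric.tendsto_nhds]
  intro ε hε
  have hg' : ContinuousWithinAt g (Set.Ici t) t := (hg t ht).mono (Set.Ici_subset_Ici.2 ht)
  have h1 := (Metric.tendsto_nhds.1 hg' (ε / 2) (by positivity)).and
    (Icc_mem_nhdsGE (show t < t + 1 by linarith))
  filter_upwards [(tendstoUOC_iff.1 h (t + 1) (by linarith) (ε / 2) (by positivity)).prod_mk h1]
    with p hp
  obtain ⟨h2, h3, h4⟩ := hp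
  have h5 := abs_lt.1 (h2 p.2 ⟨ht.trans h4.1, h4.2⟩)
  rw [Real.dist_eq] at h3 ⊢
  have h6 := abs_lt.1 h3
  rw [abs_lt]
  constructor <;> linarith

theorem eventually_lt (h : TendstoUOC f g) (h' : TendstoUOC f' g')
    (hg : ContinuousOn g (Set.Ici 0)) (hg' : ContinuousOn g' (Set.Ici 0)) {t : ℝ} (ht : 0 ≤ t)
    (hlt : g t < g' t) : ∀ᶠ p in atTop ×ˢ 𝓝[≥] t, f p.1 p.2 < f' p.1 p.2 :=
  (h.tendsto_prod hg ht).eventually_lt (h'.tendsto_prod hg' ht) hlt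

end TendstoUOC

theorem exists_Icc_of_eventually_prod {p : ℕ → ℝ → Prop} {t : ℝ}
    (h : ∀ᶠ x in atTop ×ˢ 𝓝[≥] t, p x.1 x.2) :
    ∃ b > t, ∀ᶠ n in atTop, ∀ u ∈ Set.Icc t b, p n u := by
  obtain ⟨q, hq, q', hq', h⟩ := eventually_prod_iff.1 h
  obtain ⟨b, hb, hsub⟩ := mem_nhdsGE_iff_exists_Icc_subset.1 hq'
  refine ⟨b, hb, ?_⟩
  filter_upwards [hq] with n hn u hu
  exact h hn (hsub hu)

/-! ### Right-continuous step functions -/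

/-- The infimum of the bad times could neither be good nor bad. This is the induction over events of
a trajectory, without enumerating its jump times. -/
theorem real_induction {p : ℝ → Prop} {a b : ℝ} (ha : p a)
    (hright : ∀ u ∈ Set.Ico a b, p u → ∀ᶠ s in 𝓝[>] u, p s)
    (hleft : ∀ u ∈ Set.Ioc a b, (∀ s ∈ Set.Ico a u, p s) → p u) : ∀ u ∈ Set.Icc a b, p u := by
  by_contra! hbad
  set B : Set ℝ := {u | u ∈ Set.Icc a b ∧ ¬ p u} with hB
  have hne : B.Nonempty := hbad
  have hbdd : BddBelow B := ⟨a, fun u hu => hu.1.1⟩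
  set c := sInf B with hc
  have hac : a ≤ c := le_csInf hne fun u hu => hu.1.1
  have hcb : c ≤ b := by
    obtain ⟨u, hu⟩ := hne
    exact (csInf_le hbdd hu).trans hu.1.2
  have hlt : ∀ s ∈ Set.Ico a c, p s := by
    intro s hs
    by_contra hps
    exact (csInf_le hbdd (show s ∈ B from ⟨⟨hs.1, hs.2.le.trans hcb⟩, hps⟩)).not_gt hs.2
  have hpc : p c := by
    rcases hac.eq_or_lt with h | h
    · rwa [← h]
    · exact hleft c ⟨h, hcb⟩ hlt
  have hcb' : c < b := by
    refine hcb.lt_of_ne fun h => ?_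
    obtain ⟨u, hu⟩ := hne
    have : u = c := le_antisymm (hu.1.2.trans h.ge) (csInf_le hbdd hu)
    exact hu.2 (this ▸ hpc)
  obtain ⟨d, hd, hdp⟩ := mem_nhdsGT_iff_exists_Ioo_subset.1 (hright c ⟨hac, hcb'⟩ hpc)
  have hdle : d ≤ c := by
    refine le_csInf hne fun u hu => ?_
    by_contra! hud
    have hcu : c ≤ u := csInf_le hbdd hu
    rcases hcu.eq_or_lt with h | h
    · exact hu.2 (h ▸ hpc)
    · exact hu.2 (hdp ⟨h, hud⟩)
  exact (lt_irrefl c) (lt_of_lt_of_le hd hdle)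

/-- Sampling `f` at the first point of the grid of mesh `1 / (n + 1)` strictly to the right of `t`
gives a function that factors through `ℤ`, hence is measurable, and is eventually equal to `f t`. -/
theorem aemeasurable_of_right_locally_constant {f : ℝ → ℝ}
    (hf : ∀ t, 0 ≤ t → ∀ᶠ s in 𝓝[>] t, f s = f t) :
    AEMeasurable f (volume.restrict (Set.Ici 0)) := by
  have happrox : ∀ t : ℝ, Tendsto (fun n : ℕ => ((⌊((n : ℝ) + 1) * t⌋ : ℝ) + 1) / ((n : ℝ) + 1)) atTop
      (𝓝[>] t) := by
    intro t
    have hlow : ∀ n : ℕ, t < ((⌊((n : ℝ) + 1) * t⌋ : ℝ) + 1) / ((n : ℝ) + 1) := fun n => by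
      rw [lt_div_iff₀ (by positivity), mul_comm]
      exact Int.lt_floor_add_one _
    have hup : ∀ n : ℕ, ((⌊((n : ℝ) + 1) * t⌋ : ℝ) + 1) / ((n : ℝ) + 1) ≤ t + 1 / ((n : ℝ) + 1) :=
      fun n => by
        rw [← sub_nonneg]
        have : t + 1 / ((n : ℝ) + 1) - ((⌊((n : ℝ) + 1) * t⌋ : ℝ) + 1) / ((n : ℝ) + 1) =
            (((n : ℝ) + 1) * t - ⌊((n : ℝ) + 1) * t⌋) / ((n : ℝ) + 1) := by
          field_simp; ring
        rw [this]
        exact div_nonneg (sub_nonneg.2 (Int.floor_le _)) (by positivity)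
    refine tendsto_nhdsWithin_iff.2 ⟨?_, Eventually.of_forall hlow⟩
    refine tendsto_of_tendsto_of_tendsto_of_le_of_le tendsto_const_nhds ?_ (fun n => (hlow n).le) hup
    simpa using tendsto_one_div_add_atTop_nhds_zero_nat.const_add t
  refine aemeasurable_of_tendsto_metrizable_ae' (f := fun (n : ℕ) t =>
    f (((⌊((n : ℝ) + 1) * t⌋ : ℝ) + 1) / ((n : ℝ) + 1))) (fun n => ?_) ?_
  · have h1 : Measurable fun t : ℝ => ⌊((n : ℝ) + 1) * t⌋ :=
      Int.measurable_floor.comp (measurable_const_mul _)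
    exact ((measurable_from_top (f := fun m : ℤ => f (((m : ℝ) + 1) / ((n : ℝ) + 1)))).comp
      h1).aemeasurable
  · filter_upwards [ae_restrict_mem measurableSet_Ici] with t ht
    exact tendsto_nhds_of_eventually_eq ((happrox t).eventually (hf t ht))

theorem intervalIntegrable_of_right_locally_constant {f : ℝ → ℝ} {B : ℝ}
    (hf : ∀ t, 0 ≤ t → ∀ᶠ s in 𝓝[>] t, f s = f t) (hB : ∀ t, 0 ≤ t → |f t| ≤ B) {s t : ℝ}
    (hs : 0 ≤ s) (ht : 0 ≤ t) : IntervalIntegrable f volume s t := by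
  rw [intervalIntegrable_iff]
  have hsub : Set.uIoc s t ⊆ Set.Ici 0 := fun u hu => (le_min hs ht).trans hu.1.le
  have : IsFiniteMeasure (volume.restrict (Set.uIoc s t)) := ⟨by simp [Set.uIoc]⟩
  refine Integrable.of_bound ((aemeasurable_of_right_locally_constant hf).mono_measure
    (Measure.restrict_mono hsub le_rfl)).aestronglyMeasurable B ?_
  filter_upwards [ae_restrict_mem measurableSet_uIoc] with u hu
  exact hB u (hsub hu)

set_option linter.unusedSectionVars false

variable {I J : Type*} [Fintype I] [DecidableEq I] [Fintype J] [DecidableEq J]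

/-! ### Transitions of the system -/

theorem Network.mem_S {net : Network I J} {i : I} {j : J} : j ∈ net.S i ↔ (i, j) ∈ net.E := by
  simp [Network.S]

theorem Network.mem_C {net : Network I J} {i : I} {j : J} : i ∈ net.C j ↔ (i, j) ∈ net.E := by
  simp [Network.C]

theorem sum_indicator_pair (W : Finset (I × J)) (i : I) (j : J) :
    ∑ p ∈ W, (if p.1 = i ∧ p.2 = j then (1 : ℝ) else 0) = if (i, j) ∈ W then 1 else 0 := by
  rw [← Finset.sum_ite_eq' W (i, j) fun _ => (1 : ℝ)]
  refine Finset.sum_congr rfl fun p _ => ?_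
  simp [Prod.ext_iff]

/-- The sum of a matrix of counts over a set of positions. -/
def countOn (W : Finset (I × J)) (m : I → J → ℕ) : ℝ := ∑ p ∈ W, (m p.1 p.2 : ℝ)

/-- The removed and the added unit stand on opposite sides, which avoids truncated subtraction and
includes the case where they coincide. -/
theorem countOn_balance {W : Finset (I × J)} {m m' : I → J → ℕ} {i k : I} {j l : J}
    (h : ∀ a b, m' a b + (if a = i ∧ b = j then 1 else 0) =
      m a b + if a = k ∧ b = l then 1 else 0) :
    countOn W m' + (if (i, j) ∈ W then 1 else 0) = countOn W m + if (k, l) ∈ W then 1 else 0 := by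
  rw [← sum_indicator_pair, ← sum_indicator_pair, countOn, countOn, ← Finset.sum_add_distrib,
    ← Finset.sum_add_distrib]
  refine Finset.sum_congr rfl fun p _ => ?_
  exact_mod_cast h p.1 p.2

theorem countOn_of_eq_add {W : Finset (I × J)} {m m' : I → J → ℕ} {i : I} {j : J}
    (h : ∀ a b, m' a b = m a b + if a = i ∧ b = j then 1 else 0) :
    countOn W m' = countOn W m + if (i, j) ∈ W then 1 else 0 := by
  rw [← sum_indicator_pair, countOn, countOn, ← Finset.sum_add_distrib]
  refine Finset.sum_congr rfl fun p _ => ?_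
  exact_mod_cast h p.1 p.2

theorem poolBusy_eq_countOn (net : Network I J) (z : State I J) (j : J) :
    (z.poolBusy net j : ℝ) = countOn (net.C j ×ˢ {j}) z.busy := by
  simp [State.poolBusy, countOn]

theorem total_eq_countOn (net : Network I J) (z : State I J) (i : I) :
    (z.total net i : ℝ) = z.queue i + countOn ({i} ×ˢ net.S i) z.busy := by
  simp [State.total, countOn]

theorem State.ArrivalStep.feasible {net : Network I J} {r : ℝ} {size : J → ℕ}
    (hsize : ∀ j, (size j : ℝ) = r * net.beta j) {i : I} {z z' : State I J}
    (h : State.ArrivalStep net size i z z') (hz : z.Feasible net size) : z'.Feasible net size := by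
  rcases h with ⟨⟨j₀, hj₀, hlt⟩, j, hj, hmin, hq, hb⟩ | ⟨hfull, hb, hq⟩
  · have hpool : ∀ l, (z'.poolBusy net l : ℝ) = z.poolBusy net l + if l = j then 1 else 0 := by
      intro l
      rw [poolBusy_eq_countOn, poolBusy_eq_countOn, countOn_of_eq_add hb]
      congr 1
      by_cases hl : l = j
      · subst hl
        simp [Network.mem_C, Network.mem_S.1 hj]
      · simp [hl]
    have hpool' : ∀ l, z'.poolBusy net l = z.poolBusy net l + if l = j then 1 else 0 := by
      intro l
      exact_mod_cast hpool l
    -- A full pool has load exactly `r`, whatever its size. Hence if some pool in `S(i)` has load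
    -- below `r`, so has the least loaded one.
    have hjlt : z.poolBusy net j < size j := by
      have h1 := hmin j₀ hj₀
      have hb1 := net.beta_pos j
      have hb2 := net.beta_pos j₀
      have h2 : z.load net j₀ < r := by
        rw [State.load, div_lt_iff₀ hb2, ← hsize]
        exact_mod_cast hlt
      have h3 := h1.trans_lt h2
      rw [State.load, div_lt_iff₀ hb1, ← hsize] at h3
      exact_mod_cast h3
    refine ⟨fun a b hab => ?_, fun l => ?_, fun a ha l hl => ?_⟩
    · rw [hb, hz.allowed a b hab, if_neg]
      rintro ⟨rfl, rfl⟩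
      exact hab (Network.mem_S.1 hj)
    · rw [hpool']
      by_cases hl : l = j
      · subst hl; simpa using hjlt
      · simpa [hl] using hz.capacity l
    · rw [hq] at ha
      have hfl := hz.nonidling a ha l hl
      rw [hpool', if_neg, hfl, add_zero]
      rintro rfl
      omega
  · have hpool : ∀ l, z'.poolBusy net l = z.poolBusy net l := fun l => by
      simp [State.poolBusy, hb]
    refine ⟨fun a b hab => by rw [hb]; exact hz.allowed a b hab,
      fun l => by rw [hpool]; exact hz.capacity l, fun a ha l hl => ?_⟩
    rw [hpool]
    by_cases hai : a = i
    · subst hai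
      exact le_antisymm (hz.capacity l) (hfull l hl)
    · rw [hq, if_neg hai, add_zero] at ha
      exact hz.nonidling a ha l hl

/-- If the server takes a new customer, all pool occupancies stay the same and no queue grows. If it
goes idle, no customer that it can serve is waiting. -/
theorem State.ServiceStep.feasible {net : Network I J} {size : J → ℕ} {i : I} {j : J}
    {z z' : State I J} (hij : (i, j) ∈ net.E)
    (h : State.ServiceStep net i j z z') (hz : z.Feasible net size) : z'.Feasible net size := by
  rcases h with ⟨-, k, hk, -, hq, hb⟩ | ⟨hempty, hq, hb⟩
  · have hpool : ∀ l, z'.poolBusy net l = z.poolBusy net l := by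
      intro l
      have h1 := countOn_balance (W := net.C l ×ˢ {l}) hb
      rw [← poolBusy_eq_countOn, ← poolBusy_eq_countOn] at h1
      have hi : i ∈ net.C j := Network.mem_C.2 hij
      by_cases hl : l = j
      · subst hl
        simp only [Finset.mem_product, hi, hk, Finset.mem_singleton, and_self, if_true] at h1
        exact_mod_cast add_right_cancel h1
      · simp only [Finset.mem_product, Finset.mem_singleton, Ne.symm hl, and_false, if_false,
          add_zero] at h1
        exact_mod_cast h1
    refine ⟨fun a b hab => ?_, fun l => by rw [hpool]; exact hz.capacity l, fun a ha l hl => ?_⟩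
    · have h1 := hb a b
      rw [hz.allowed a b hab, if_neg (c := a = k ∧ b = j)] at h1
      · omega
      · rintro ⟨rfl, rfl⟩
        exact hab (Network.mem_C.1 hk)
    · rw [hpool]
      have := hq a
      exact hz.nonidling a (by omega) l hl
  · have hle : ∀ a b, z'.busy a b ≤ z.busy a b := fun a b => by have := hb a b; omega
    refine ⟨fun a b hab => ?_, fun l => ?_, fun a ha l hl => ?_⟩
    · have := hle a b
      rw [hz.allowed a b hab] at this
      omega
    · exact (Finset.sum_le_sum fun a _ => hle a l).trans (hz.capacity l)
    · rw [hq] at ha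
      rw [← hz.nonidling a ha l hl]
      refine Finset.sum_congr rfl fun c _ => ?_
      have h1 := hb c l
      rw [if_neg] at h1
      · simpa using h1
      · rintro ⟨rfl, rfl⟩
        have := hempty a (Network.mem_C.2 (Network.mem_S.1 hl))
        omega

/-- The numbers of arrivals and of service completions so far, and the state of the system. -/
structure Config (I J : Type*) where
  arrived : I → ℕ
  completed : I → J → ℕ
  state : State I J

/-- The possible changes of the configuration: none, an arrival, or a service completion. -/
def Config.Transition (net : Network I J) (size : J → ℕ) (c c' : Config I J) : Prop :=
  c' = c ∨
  (∃ i, (∀ a, c'.arrived a = c.arrived a + if a = i then 1 else 0) ∧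
    c'.completed = c.completed ∧ State.ArrivalStep net size i c.state c'.state) ∨
  (∃ i j, (i, j) ∈ net.E ∧ c'.arrived = c.arrived ∧
    (∀ a b, c'.completed a b = c.completed a b + if a = i ∧ b = j then 1 else 0) ∧
    State.ServiceStep net i j c.state c'.state)

section

variable {net : Network I J} {size : J → ℕ} {c c' : Config I J}

theorem Config.Transition.feasible {r : ℝ} (hsize : ∀ j, (size j : ℝ) = r * net.beta j)
    (h : c.Transition net size c') (hc : c.state.Feasible net size) :
    c'.state.Feasible net size := by
  rcases h with rfl | ⟨i, -, -, h⟩ | ⟨i, j, hij, -, -, h⟩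
  · exact hc
  · exact h.feasible hsize hc
  · exact h.feasible hij hc

/-- The total number of arrivals and service completions. -/
def Config.events (c : Config I J) : ℝ := ∑ i, (c.arrived i : ℝ) + countOn Finset.univ c.completed

theorem Config.Transition.events_le (h : c.Transition net size c') : c.events ≤ c'.events := by
  rcases h with rfl | ⟨k, ha, hd, -⟩ | ⟨k, l, -, ha, hd, -⟩
  · rfl
  · simp [Config.events, ha, hd, Finset.sum_add_distrib]
  · simp [Config.events, ha, countOn_of_eq_add hd]

/-- An event starts at most one service and ends at most one, and both cannot move an entry in the
same direction. -/
theorem Config.Transition.abs_busy_sub_le (h : c.Transition net size c') (i : I) (j : J) :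
    |(c'.state.busy i j : ℝ) - c.state.busy i j| ≤ c'.events - c.events := by
  rcases h with rfl | ⟨k, ha, hd, h⟩ | ⟨k, l, -, ha, hd, h⟩
  · simp
  · have hev : c'.events - c.events = 1 := by
      simp [Config.events, ha, hd, Finset.sum_add_distrib]
    rw [hev, abs_le]
    rcases h with ⟨-, j, -, -, -, hb⟩ | ⟨-, hb, -⟩
    · rw [hb]
      push_cast
      split_ifs <;> constructor <;> linarith
    · rw [hb]
      simp
  · have hev : c'.events - c.events = 1 := by
      simp [Config.events, ha, countOn_of_eq_add hd]
    rw [hev, abs_le]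
    rcases h with ⟨-, m, -, -, -, hb⟩ | ⟨-, -, hb⟩
    · have h1 : (c'.state.busy i j : ℝ) + (if i = k ∧ j = l then 1 else 0) =
        c.state.busy i j + if i = m ∧ j = l then 1 else 0 := by exact_mod_cast hb i j
      split_ifs at h1 <;> constructor <;> linarith
    · have h1 : (c'.state.busy i j : ℝ) + (if i = k ∧ j = l then 1 else 0) =
        c.state.busy i j := by exact_mod_cast hb i j
      split_ifs at h1 <;> constructor <;> linarith

theorem Config.Transition.abs_queue_sub_le (h : c.Transition net size c') (i : I) :
    |(c'.state.queue i : ℝ) - c.state.queue i| ≤ c'.events - c.events := by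
  rcases h with rfl | ⟨k, ha, hd, h⟩ | ⟨k, l, -, ha, hd, h⟩
  · simp
  · have hev : c'.events - c.events = 1 := by
      simp [Config.events, ha, hd, Finset.sum_add_distrib]
    rw [hev, abs_le]
    rcases h with ⟨-, j, -, -, hq, -⟩ | ⟨-, -, hq⟩
    · rw [hq]
      simp
    · rw [hq]
      push_cast
      split_ifs <;> constructor <;> linarith
  · have hev : c'.events - c.events = 1 := by
      simp [Config.events, ha, countOn_of_eq_add hd]
    rw [hev, abs_le]
    rcases h with ⟨-, m, -, -, hq, -⟩ | ⟨-, hq, -⟩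
    · have h1 : (c'.state.queue i : ℝ) + (if i = m then 1 else 0) = c.state.queue i := by
        exact_mod_cast hq i
      split_ifs at h1 <;> constructor <;> linarith
    · rw [hq]
      simp

/-- Customers enter only by arrival and leave only by completion; a move from a queue to a server
keeps the type. -/
theorem Config.Transition.total_balance (h : c.Transition net size c') (i : I) :
    (c'.state.total net i : ℝ) - c'.arrived i + countOn ({i} ×ˢ net.S i) c'.completed =
      c.state.total net i - c.arrived i + countOn ({i} ×ˢ net.S i) c.completed := by
  have hmem : ∀ k l, (k, l) ∈ net.E → ((k, l) ∈ {i} ×ˢ net.S i ↔ i = k) := by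
    intro k l hkl
    simp only [Finset.mem_product, Finset.mem_singleton, Network.mem_S]
    constructor
    · rintro ⟨rfl, -⟩; rfl
    · rintro rfl; exact ⟨rfl, hkl⟩
  rw [total_eq_countOn, total_eq_countOn]
  rcases h with rfl | ⟨k, ha, hd, h⟩ | ⟨k, l, hkl, ha, hd, h⟩
  · rfl
  · rw [ha, hd]
    rcases h with ⟨-, l, hl, -, hq, hb⟩ | ⟨-, hb, hq⟩
    · rw [hq, countOn_of_eq_add hb]
      simp only [hmem k l (Network.mem_S.1 hl)]
      push_cast
      ring
    · rw [hq, hb]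
      push_cast
      ring
  · rw [ha, countOn_of_eq_add hd]
    simp only [hmem k l hkl]
    rcases h with ⟨-, m, hm, -, hq, hb⟩ | ⟨-, hq, hb⟩
    · have h1 := countOn_balance (W := {i} ×ˢ net.S i) hb
      simp only [hmem k l hkl, hmem m l (Network.mem_C.1 hm)] at h1
      have h2 : (c'.state.queue i : ℝ) + (if i = m then 1 else 0) = c.state.queue i := by
        exact_mod_cast hq i
      linarith
    · have h1 := countOn_of_eq_add (W := {i} ×ˢ net.S i) (fun a b => (hb a b).symm)
      simp only [hmem k l hkl] at h1
      rw [hq]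
      linarith

/-- `W` holds the activities of the group and `U` all activities of the pools involved. Arrivals
leave the busy counts on `W` alone: a positive queue forces the pools of its type to be full. A
completion in a pool `l` starts a service in `W` exactly when `l` is one of these pools: a type
outside `Is` would lose to a strictly longer queue in `Is`, and some queue is always waiting. -/
theorem Config.Transition.longest_queue (h : c.Transition net size c')
    (hc : c.state.Feasible net size) {Is : Finset I} {Js : Finset J} {W U : Finset (I × J)}
    (hW : ∀ p, p ∈ W ↔ p.1 ∈ Is ∧ p.2 ∈ net.S p.1 ∩ Js)
    (hU : ∀ p, p ∈ U ↔ p.2 ∈ Is.biUnion (fun i => net.S i ∩ Js) ∧ p.1 ∈ net.C p.2)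
    (hpos : ∀ i ∈ Is, 0 < c.state.queue i)
    (hlt : ∀ i ∈ Is, ∀ i' ∉ Is, (net.S i ∩ net.S i' ∩ Js).Nonempty →
      c.state.queue i' < c.state.queue i) :
    countOn W c'.state.busy - countOn U c'.completed + countOn W c'.completed =
      countOn W c.state.busy - countOn U c.completed + countOn W c.completed := by
  rcases h with rfl | ⟨k, ha, hd, h⟩ | ⟨k, l, hkl, ha, hd, h⟩
  · rfl
  · rw [hd]
    rcases h with ⟨⟨j₀, hj₀, hj₀lt⟩, l, hl, -, -, hb⟩ | ⟨-, hb, -⟩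
    · rw [countOn_of_eq_add hb, if_neg, add_zero]
      intro hkl
      have := hc.nonidling k (hpos k ((hW _).1 hkl).1) j₀ hj₀
      omega
    · rw [hb]
  · rw [countOn_of_eq_add hd, countOn_of_eq_add hd]
    have hUl : ∀ m, (m, l) ∈ net.E →
        ((m, l) ∈ U ↔ l ∈ Is.biUnion (fun i => net.S i ∩ Js)) := by
      intro m hm
      rw [hU]
      exact and_iff_left (Network.mem_C.2 hm)
    simp only [hUl k hkl]
    rcases h with ⟨-, m, hm, hmax, -, hb⟩ | ⟨hempty, -, hb⟩
    · have h1 := countOn_balance (W := W) hb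
      have hWm : (m, l) ∈ W ↔ l ∈ Is.biUnion (fun i => net.S i ∩ Js) := by
        rw [hW, Finset.mem_biUnion]
        refine ⟨fun h => ⟨m, h⟩, ?_⟩
        rintro ⟨i, hi, hil⟩
        rw [Finset.mem_inter] at hil
        have hml : l ∈ net.S m := Network.mem_S.2 (Network.mem_C.1 hm)
        refine ⟨?_, Finset.mem_inter.2 ⟨hml, hil.2⟩⟩
        by_contra hmI
        have h2 := hlt i hi m hmI
          ⟨l, Finset.mem_inter.2 ⟨Finset.mem_inter.2 ⟨hil.1, hml⟩, hil.2⟩⟩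
        have h3 := hmax i (Network.mem_C.2 (Network.mem_S.1 hil.1))
        omega
      simp only [hWm] at h1
      linarith
    · have h1 := countOn_of_eq_add (W := W) (fun a b => (hb a b).symm)
      have hl : l ∉ Is.biUnion (fun i => net.S i ∩ Js) := by
        rw [Finset.mem_biUnion]
        rintro ⟨i, hi, hil⟩
        have h2 := hempty i (Network.mem_C.2 (Network.mem_S.1 (Finset.mem_inter.1 hil).1))
        have h3 := hpos i hi
        omega
      simp only [hl, if_false]
      linarith

/-- An arrival of a relevant type finds a free server, and a pool outside `Js` would lose to a
strictly less loaded one in `Js`. Since pools in `Js` are not full, no customer that they can serve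
is waiting, so completions there start no service. -/
theorem Config.Transition.freest_server (h : c.Transition net size c')
    (hc : c.state.Feasible net size) {Is : Finset I} {Js : Finset J} {W : Finset (I × J)}
    (hW : ∀ p, p ∈ W ↔ p.2 ∈ Js ∧ p.1 ∈ net.C p.2 ∩ Is)
    (hfree : ∀ j ∈ Js, c.state.poolBusy net j < size j)
    (hlt : ∀ j ∈ Js, ∀ j' ∉ Js, (net.C j ∩ net.C j' ∩ Is).Nonempty →
      c.state.load net j < c.state.load net j') :
    countOn W c'.state.busy - ∑ i ∈ Js.biUnion (fun j => net.C j ∩ Is), (c'.arrived i : ℝ) +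
        countOn W c'.completed =
      countOn W c.state.busy - ∑ i ∈ Js.biUnion (fun j => net.C j ∩ Is), (c.arrived i : ℝ) +
        countOn W c.completed := by
  rcases h with rfl | ⟨k, ha, hd, h⟩ | ⟨k, l, hkl, ha, hd, h⟩
  · rfl
  · have hsum : ∑ i ∈ Js.biUnion (fun j => net.C j ∩ Is), (c'.arrived i : ℝ) =
        ∑ i ∈ Js.biUnion (fun j => net.C j ∩ Is), (c.arrived i : ℝ) +
          if k ∈ Js.biUnion (fun j => net.C j ∩ Is) then 1 else 0 := by
      simp only [ha, Nat.cast_add, Finset.sum_add_distrib, Nat.cast_ite, Nat.cast_one,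
        Nat.cast_zero, Finset.sum_ite_eq']
    rw [hsum, hd]
    rcases h with ⟨-, l, hl, hmin, -, hb⟩ | ⟨hfull, hb, -⟩
    · have hWl : (k, l) ∈ W ↔ k ∈ Js.biUnion (fun j => net.C j ∩ Is) := by
        rw [hW, Finset.mem_biUnion]
        refine ⟨fun h => ⟨l, h⟩, ?_⟩
        rintro ⟨j, hj, hjk⟩
        rw [Finset.mem_inter] at hjk
        have hkl : k ∈ net.C l := Network.mem_C.2 (Network.mem_S.1 hl)
        refine ⟨?_, Finset.mem_inter.2 ⟨hkl, hjk.2⟩⟩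
        by_contra hlJ
        have h2 := hlt j hj l hlJ
          ⟨k, Finset.mem_inter.2 ⟨Finset.mem_inter.2 ⟨hjk.1, hkl⟩, hjk.2⟩⟩
        exact (hmin j (Network.mem_S.2 (Network.mem_C.1 hjk.1))).not_gt h2
      rw [countOn_of_eq_add hb]
      simp only [hWl]
      ring
    · have hk : k ∉ Js.biUnion (fun j => net.C j ∩ Is) := by
        rw [Finset.mem_biUnion]
        rintro ⟨j, hj, hjk⟩
        have h2 := hfull j (Network.mem_S.2 (Network.mem_C.1 (Finset.mem_inter.1 hjk).1))
        have h3 := hfree j hj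
        omega
      rw [hb, if_neg hk]
      ring
  · rw [ha, countOn_of_eq_add hd]
    rcases h with ⟨⟨m₀, hm₀, hm₀pos⟩, m, hm, hmax, -, hb⟩ | ⟨-, -, hb⟩
    · have h1 := countOn_balance (W := W) hb
      have hl : l ∉ Js := fun hl => by
        have h2 := hc.nonidling m₀ hm₀pos l (Network.mem_S.2 (Network.mem_C.1 hm₀))
        have h3 := hfree l hl
        omega
      have hn : ∀ a, (a, l) ∉ W := fun a ha => hl ((hW _).1 ha).1
      simp only [hn, if_false] at h1 ⊢
      linarith
    · have h1 := countOn_of_eq_add (W := W) (fun a b => (hb a b).symm)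
      linarith

end

/-! ### Paths of one system -/

/-- The number of service completions along the activity `(i, j)`, which is zero if the activity is
not allowed. -/
noncomputable def completions (net : Network I J) (r : ℝ) (S : net.E → ℝ → ℕ) (Z : ℝ → State I J)
    (i : I) (j : J) (t : ℝ) : ℕ :=
  if h : (i, j) ∈ net.E then departures net r S Z ⟨(i, j), h⟩ t else 0

/-- A trajectory of the system, with drivers that start from zero and are right-continuous. -/
structure IsDrivenPath (net : Network I J) (r : ℝ) (size : J → ℕ)
    (A : I → ℝ → ℕ) (S : net.E → ℝ → ℕ) (Z : ℝ → State I J) : Prop where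
  path : IsLQFSPath net r size A S Z
  r_pos : 0 < r
  size_eq : ∀ j, (size j : ℝ) = r * net.beta j
  arrivals_zero : ∀ i, A i 0 = 0
  services_zero : ∀ e, S e 0 = 0
  arrivals_right : ∀ i t, 0 ≤ t → ∀ᶠ s in 𝓝[≥] t, A i s = A i t
  services_right : ∀ e t, 0 ≤ t → ∀ᶠ s in 𝓝[≥] t, S e s = S e t

namespace IsDrivenPath

variable {net : Network I J} {r : ℝ} {size : J → ℕ} {A : I → ℝ → ℕ} {S : net.E → ℝ → ℕ}
  {Z : ℝ → State I J}

/-- The configuration of the system at a given time. -/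
noncomputable def config (net : Network I J) (r : ℝ) (A : I → ℝ → ℕ) (S : net.E → ℝ → ℕ)
    (Z : ℝ → State I J) (t : ℝ) : Config I J :=
  ⟨fun i => A i t, fun i j => completions net r S Z i j t, Z t⟩

theorem transition (h : IsDrivenPath net r size A S Z) {t : ℝ} (ht : 0 < t) :
    ∀ᶠ s in 𝓝[<] t, (config net r A S Z s).Transition net size (config net r A S Z t) := by
  filter_upwards [h.path.jump t ht] with s hs
  rcases hs with ⟨hA, hD, hZ⟩ | ⟨i, hA, hD, hZ⟩ | ⟨e, hA, hD, hZ⟩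
  · left
    simp only [config, hA, hZ, completions, hD]
  · right; left
    exact ⟨i, hA, by simp only [config, completions, hD], hZ⟩
  · right; right
    refine ⟨e.1.1, e.1.2, e.2, by simp only [config, hA], fun a b => ?_, hZ⟩
    simp only [config, completions]
    split_ifs with hab hab' hab'
    · rw [hD, if_pos (Subtype.ext (Prod.ext hab'.1 hab'.2))]
    · rw [hD, if_neg]
      rintro rfl
      exact hab' ⟨rfl, rfl⟩
    · exact absurd (by rw [hab'.1, hab'.2]; exact e.2) hab
    · rfl

theorem feasible (h : IsDrivenPath net r size A S Z) {t : ℝ} (ht : 0 ≤ t) :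
    (Z t).Feasible net size := by
  refine real_induction (p := fun t => (Z t).Feasible net size) (a := 0) (b := t) h.path.initial
    (fun u hu hf => ?_) (fun u hu hf => ?_) t ⟨ht, le_rfl⟩
  · filter_upwards [h.path.right_cont u hu.1] with s hs
    rwa [hs]
  · obtain ⟨s, hs, hs0⟩ := ((h.transition hu.1).and (Ico_mem_nhdsLT hu.1)).exists
    exact hs.feasible h.size_eq (hf s hs0)

theorem busy_le (h : IsDrivenPath net r size A S Z) (i : I) (j : J) {t : ℝ} (ht : 0 ≤ t) :
    ((Z t).busy i j : ℝ) ≤ r * net.beta j := by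
  have hf := h.feasible ht
  rw [← h.size_eq]
  by_cases hij : (i, j) ∈ net.E
  · exact_mod_cast (Finset.single_le_sum (f := fun i => (Z t).busy i j) (fun _ _ => Nat.zero_le _)
      (Network.mem_C.2 hij)).trans (hf.capacity j)
  · rw [hf.allowed i j hij]
    exact_mod_cast Nat.zero_le _

theorem intervalIntegrable_busy (h : IsDrivenPath net r size A S Z) (i : I) (j : J) {s t : ℝ}
    (hs : 0 ≤ s) (ht : 0 ≤ t) :
    IntervalIntegrable (fun u => ((Z u).busy i j : ℝ)) volume s t := by
  refine intervalIntegrable_of_right_locally_constant (B := r * net.beta j) (fun u hu => ?_)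
    (fun u hu => ?_) hs ht
  · filter_upwards [h.path.right_cont u hu] with v hv
    rw [hv]
  · rw [abs_of_nonneg (Nat.cast_nonneg _)]
    exact h.busy_le i j hu

/-- The scaled total time spent by time `t` on services along the activity `(i, j)`. -/
noncomputable def serviceTime (r : ℝ) (Z : ℝ → State I J) (i : I) (j : J) (t : ℝ) : ℝ :=
  r⁻¹ * ∫ s in (0 : ℝ)..t, ((Z s).busy i j : ℝ)

theorem serviceTime_zero (i : I) (j : J) : serviceTime r Z i j 0 = 0 := by simp [serviceTime]

/-- The scaled busy count lies between `0` and `β_j`; the bound does not depend on `r`. -/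
theorem serviceTime_sub (h : IsDrivenPath net r size A S Z) (i : I) (j : J) {s t : ℝ}
    (hs : 0 ≤ s) (hst : s ≤ t) :
    serviceTime r Z i j t - serviceTime r Z i j s ∈ Set.Icc 0 (net.beta j * (t - s)) := by
  have hsub : serviceTime r Z i j t - serviceTime r Z i j s =
      r⁻¹ * ∫ u in s..t, ((Z u).busy i j : ℝ) := by
    rw [serviceTime, serviceTime, ← mul_sub, intervalIntegral.integral_interval_sub_left
      (h.intervalIntegrable_busy i j le_rfl (hs.trans hst)) (h.intervalIntegrable_busy i j le_rfl hs)]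
  have hr := h.r_pos
  rw [hsub]
  refine ⟨mul_nonneg (inv_nonneg.2 hr.le)
    (intervalIntegral.integral_nonneg hst fun u _ => Nat.cast_nonneg _), ?_⟩
  rw [inv_mul_le_iff₀ hr]
  calc ∫ u in s..t, ((Z u).busy i j : ℝ) ≤ ∫ _ in s..t, r * net.beta j :=
        intervalIntegral.integral_mono_on hst (h.intervalIntegrable_busy i j hs (hs.trans hst))
          intervalIntegrable_const fun u hu => h.busy_le i j (hs.trans hu.1)
    _ = r * (net.beta j * (t - s)) := by
        rw [intervalIntegral.integral_const, smul_eq_mul]; ring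

theorem serviceTime_mem (h : IsDrivenPath net r size A S Z) (i : I) (j : J) {t : ℝ}
    (ht : 0 ≤ t) : serviceTime r Z i j t ∈ Set.Icc 0 (net.beta j * t) := by
  simpa [serviceTime_zero] using h.serviceTime_sub i j le_rfl ht

theorem completions_zero (h : IsDrivenPath net r size A S Z) (i : I) (j : J) :
    completions net r S Z i j 0 = 0 := by
  rw [completions]
  split_ifs with hij
  · simp [departures, h.services_zero]
  · rfl

/-- The completion counts are right-continuous because the service time is continuous and
nondecreasing: it approaches its value at `t` from the side on which the driver is locally constant.
-/
theorem config_right (h : IsDrivenPath net r size A S Z) {t : ℝ} (ht : 0 ≤ t) :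
    ∀ᶠ s in 𝓝[>] t, config net r A S Z s = config net r A S Z t := by
  have hle : 𝓝[>] t ≤ 𝓝[≥] t := nhdsWithin_mono t Set.Ioi_subset_Ici_self
  have hA : ∀ᶠ s in 𝓝[>] t, ∀ i, A i s = A i t :=
    eventually_all.2 fun i => hle (h.arrivals_right i t ht)
  have hD : ∀ᶠ s in 𝓝[>] t, ∀ i j, completions net r S Z i j s = completions net r S Z i j t := by
    refine eventually_all.2 fun i => eventually_all.2 fun j => ?_
    by_cases hij : (i, j) ∈ net.E
    · have htend : Tendsto (serviceTime r Z i j) (𝓝[>] t) (𝓝[≥] (serviceTime r Z i j t)) := by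
        have hev : ∀ᶠ s in 𝓝[>] t, serviceTime r Z i j t ≤ serviceTime r Z i j s ∧
            serviceTime r Z i j s ≤ serviceTime r Z i j t + net.beta j * (s - t) := by
          filter_upwards [self_mem_nhdsWithin] with s hs
          have := h.serviceTime_sub i j ht (le_of_lt hs)
          exact ⟨by linarith [this.1], by linarith [this.2]⟩
        refine tendsto_nhdsWithin_iff.2 ⟨?_, hev.mono fun s hs => hs.1⟩
        refine tendsto_of_tendsto_of_tendsto_of_le_of_le' tendsto_const_nhds ?_
          (hev.mono fun s hs => hs.1) (hev.mono fun s hs => hs.2)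
        have hc : Continuous fun s : ℝ => serviceTime r Z i j t + net.beta j * (s - t) := by
          fun_prop
        have := (hc.tendsto t).mono_left (nhdsWithin_le_nhds (s := Set.Ioi t))
        simpa using this
      filter_upwards [htend.eventually (h.services_right ⟨(i, j), hij⟩ _
        (h.serviceTime_mem i j ht).1)] with s hs
      simp only [completions, hij, dif_pos]
      exact hs
    · simp [completions, hij]
  filter_upwards [hA, hD, h.path.right_cont t ht] with s h1 h2 h3
  simp only [config, h1, h2, h3]

/-- The bridge from single transitions to whole paths, by induction over real time. The condition on
a transition concerns only the configuration before it, so hypotheses on the path during `[a, b)`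
suffice. -/
theorem le_of_transition_le (h : IsDrivenPath net r size A S Z) (F : Config I J → ℝ) {a b : ℝ}
    (ha : 0 ≤ a) (hab : a ≤ b)
    (hF : ∀ s ∈ Set.Ico a b, ∀ c', (config net r A S Z s).Transition net size c' →
      F (config net r A S Z s) ≤ F c') :
    F (config net r A S Z a) ≤ F (config net r A S Z b) := by
  refine real_induction (p := fun t => F (config net r A S Z a) ≤ F (config net r A S Z t))
    (a := a) (b := b) le_rfl (fun u hu hf => ?_) (fun u hu hf => ?_) b ⟨hab, le_rfl⟩
  · filter_upwards [h.config_right (ha.trans hu.1)] with s hs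
    rwa [hs]
  · obtain ⟨s, hs, hs0⟩ := ((h.transition (ha.trans_lt hu.1)).and (Ico_mem_nhdsLT hu.1)).exists
    exact (hf s hs0).trans (hF s ⟨hs0.1, hs0.2.trans_le hu.2⟩ _ hs)

theorem eq_of_transition_eq (h : IsDrivenPath net r size A S Z) (F : Config I J → ℝ) {a b : ℝ}
    (ha : 0 ≤ a) (hab : a ≤ b)
    (hF : ∀ s ∈ Set.Ico a b, ∀ c', (config net r A S Z s).Transition net size c' →
      F c' = F (config net r A S Z s)) :
    F (config net r A S Z b) = F (config net r A S Z a) :=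
  le_antisymm
    (neg_le_neg_iff.1 (h.le_of_transition_le (fun c => -F c) ha hab fun s hs c' hc =>
      neg_le_neg_iff.2 (hF s hs c' hc).le))
    (h.le_of_transition_le F ha hab fun s hs c' hc => (hF s hs c' hc).ge)

theorem abs_sub_le_events (h : IsDrivenPath net r size A S Z) (G : Config I J → ℝ)
    (hG : ∀ c c', c.Transition net size c' → |G c' - G c| ≤ c'.events - c.events) {a b : ℝ}
    (ha : 0 ≤ a) (hab : a ≤ b) :
    |G (config net r A S Z b) - G (config net r A S Z a)| ≤
      (config net r A S Z b).events - (config net r A S Z a).events := by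
  -- Both `events - G` and `events + G` are nondecreasing along the path.
  have h1 := h.le_of_transition_le (fun c => c.events - G c) ha hab fun s _ c' hc => by
    linarith [(abs_le.1 (hG _ c' hc)).2]
  have h2 := h.le_of_transition_le (fun c => c.events + G c) ha hab fun s _ c' hc => by
    linarith [(abs_le.1 (hG _ c' hc)).1]
  rw [abs_le]
  constructor <;> linarith

theorem total_eq (h : IsDrivenPath net r size A S Z) (i : I) {t : ℝ} (ht : 0 ≤ t) :
    ((Z t).total net i : ℝ) = (Z 0).total net i + A i t -
      ∑ j ∈ net.S i, (completions net r S Z i j t : ℝ) := by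
  have h1 := h.eq_of_transition_eq (fun c => (c.state.total net i : ℝ) - c.arrived i +
    countOn ({i} ×ˢ net.S i) c.completed) le_rfl ht fun s _ c' hc => hc.total_balance i
  simp only [config, countOn, Finset.sum_product, Finset.sum_singleton, h.arrivals_zero,
    h.completions_zero] at h1
  simp only [Nat.cast_zero, Finset.sum_const_zero] at h1
  linarith

theorem longest_queue (h : IsDrivenPath net r size A S Z) {Is : Finset I} {Js : Finset J} {a b : ℝ}
    (ha : 0 ≤ a) (hab : a ≤ b)
    (hpos : ∀ u ∈ Set.Icc a b, ∀ i ∈ Is, 0 < (Z u).queue i)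
    (hlt : ∀ u ∈ Set.Icc a b, ∀ i ∈ Is, ∀ i' ∉ Is, (net.S i ∩ net.S i' ∩ Js).Nonempty →
      (Z u).queue i' < (Z u).queue i) :
    ∑ i ∈ Is, ∑ j ∈ net.S i ∩ Js, (((Z b).busy i j : ℝ) - (Z a).busy i j) =
      (∑ j ∈ Is.biUnion (fun i => net.S i ∩ Js), ∑ i' ∈ net.C j,
        ((completions net r S Z i' j b : ℝ) - completions net r S Z i' j a)) -
      ∑ i ∈ Is, ∑ j ∈ net.S i ∩ Js,
        ((completions net r S Z i j b : ℝ) - completions net r S Z i j a) := by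
  classical
  set W : Finset (I × J) := {p | p.1 ∈ Is ∧ p.2 ∈ net.S p.1 ∩ Js} with hWdef
  set U : Finset (I × J) := {p | p.2 ∈ Is.biUnion (fun i => net.S i ∩ Js) ∧ p.1 ∈ net.C p.2}
    with hUdef
  have hW : ∀ p, p ∈ W ↔ p.1 ∈ Is ∧ p.2 ∈ net.S p.1 ∩ Js := fun p => by simp [hWdef]
  have hU : ∀ p, p ∈ U ↔ p.2 ∈ Is.biUnion (fun i => net.S i ∩ Js) ∧ p.1 ∈ net.C p.2 :=
    fun p => by simp only [hUdef, Finset.mem_filter, Finset.mem_univ, true_and]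
  have h1 := h.eq_of_transition_eq (fun c => countOn W c.state.busy - countOn U c.completed +
    countOn W c.completed) ha hab fun s hs c' hc =>
      hc.longest_queue (h.feasible (ha.trans hs.1)) hW hU (hpos s ⟨hs.1, hs.2.le⟩)
        (hlt s ⟨hs.1, hs.2.le⟩)
  simp only [config, countOn] at h1
  rw [← Finset.sum_finset_product W Is _ hW (f := fun p => ((Z b).busy p.1 p.2 : ℝ) - (Z a).busy p.1 p.2),
    ← Finset.sum_finset_product W Is _ hW (f := fun p =>
      (completions net r S Z p.1 p.2 b : ℝ) - completions net r S Z p.1 p.2 a),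
    ← Finset.sum_finset_product_right U _ _ hU (f := fun p =>
      (completions net r S Z p.1 p.2 b : ℝ) - completions net r S Z p.1 p.2 a)]
  simp only [Finset.sum_sub_distrib]
  linarith

theorem freest_server (h : IsDrivenPath net r size A S Z) {Is : Finset I} {Js : Finset J} {a b : ℝ}
    (ha : 0 ≤ a) (hab : a ≤ b)
    (hfree : ∀ u ∈ Set.Icc a b, ∀ j ∈ Js, (Z u).poolBusy net j < size j)
    (hlt : ∀ u ∈ Set.Icc a b, ∀ j ∈ Js, ∀ j' ∉ Js, (net.C j ∩ net.C j' ∩ Is).Nonempty →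
      (Z u).load net j < (Z u).load net j') :
    ∑ j ∈ Js, ∑ i ∈ net.C j ∩ Is, (((Z b).busy i j : ℝ) - (Z a).busy i j) =
      (∑ i ∈ Js.biUnion (fun j => net.C j ∩ Is), ((A i b : ℝ) - A i a)) -
      ∑ j ∈ Js, ∑ i ∈ net.C j ∩ Is,
        ((completions net r S Z i j b : ℝ) - completions net r S Z i j a) := by
  classical
  set W : Finset (I × J) := {p | p.2 ∈ Js ∧ p.1 ∈ net.C p.2 ∩ Is} with hWdef
  have hW : ∀ p, p ∈ W ↔ p.2 ∈ Js ∧ p.1 ∈ net.C p.2 ∩ Is := fun p => by simp [hWdef]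
  have h1 := h.eq_of_transition_eq (fun c => countOn W c.state.busy -
    ∑ i ∈ Js.biUnion (fun j => net.C j ∩ Is), (c.arrived i : ℝ) + countOn W c.completed) ha hab
      fun s hs c' hc => hc.freest_server (h.feasible (ha.trans hs.1)) hW (hfree s ⟨hs.1, hs.2.le⟩)
        (hlt s ⟨hs.1, hs.2.le⟩)
  simp only [config, countOn] at h1
  rw [← Finset.sum_finset_product_right W Js _ hW (f := fun p => ((Z b).busy p.1 p.2 : ℝ) - (Z a).busy p.1 p.2),
    ← Finset.sum_finset_product_right W Js _ hW (f := fun p =>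
      (completions net r S Z p.1 p.2 b : ℝ) - completions net r S Z p.1 p.2 a)]
  simp only [Finset.sum_sub_distrib]
  linarith

end IsDrivenPath

/-! ### Fluid limits -/

open IsDrivenPath in
-- Up to time `T` the service time stays in `[0, β_j T]` for all `n`, so it can be substituted into
-- the uniform law of large numbers on that interval.
theorem IsDrivenPath.tendstoUOC_completions {net : Network I J} {r : ℕ → ℝ} {size : ℕ → J → ℕ}
    {A : ℕ → I → ℝ → ℕ} {S : ℕ → net.E → ℝ → ℕ} {Z : ℕ → ℝ → State I J}
    (h : ∀ n, IsDrivenPath net (r n) (size n) (A n) (S n) (Z n))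
    (hS : ∀ e, TendstoUOC (fun n t => (S n e t : ℝ) / r n) (fun t => net.mu e.1.1 e.1.2 * t))
    {i : I} {j : J} (hij : (i, j) ∈ net.E) :
    TendstoUOC (fun n t => (completions net (r n) (S n) (Z n) i j t : ℝ) / r n -
      net.mu i j * serviceTime (r n) (Z n) i j t) (fun _ => 0) := by
  refine tendstoUOC_iff.2 fun T hT ε hε => ?_
  have hβ := net.beta_pos j
  filter_upwards [tendstoUOC_iff.1 (hS ⟨(i, j), hij⟩) (net.beta j * T) (by positivity) ε hε]
    with n hn t ht
  have hm := (h n).serviceTime_mem i j ht.1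
  have := hn (serviceTime (r n) (Z n) i j t) ⟨hm.1, hm.2.trans (by gcongr; exact ht.2)⟩
  simpa [completions, hij, departures, serviceTime] using this

open IsDrivenPath in
-- Arrivals contribute slope `λ_i`, and each allowed activity contributes `μ_ij β_j`.
theorem IsDrivenPath.exists_asymptoticallyLipschitz_events {net : Network I J} {r : ℕ → ℝ}
    {size : ℕ → J → ℕ} {A : ℕ → I → ℝ → ℕ} {S : ℕ → net.E → ℝ → ℕ} {Z : ℕ → ℝ → State I J}
    (h : ∀ n, IsDrivenPath net (r n) (size n) (A n) (S n) (Z n))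
    (hA : ∀ i, TendstoUOC (fun n t => (A n i t : ℝ) / r n) (fun t => net.lam i * t))
    (hS : ∀ e, TendstoUOC (fun n t => (S n e t : ℝ) / r n) (fun t => net.mu e.1.1 e.1.2 * t)) :
    ∃ K, IsAsymptoticallyLipschitz K
      (fun n t => (config net (r n) (A n) (S n) (Z n) t).events / r n) := by
  have hAL : ∀ i, ∃ K, IsAsymptoticallyLipschitz K (fun n t => (A n i t : ℝ) / r n) := by
    intro i
    refine ⟨⟨net.lam i, (net.lam_pos i).le⟩, .of_approx (g := fun _ t => net.lam i * t)
      (fun n s hs t hst => ?_) ?_⟩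
    · rw [← mul_sub, abs_of_nonneg (mul_nonneg (net.lam_pos i).le (sub_nonneg.2 hst))]
      rfl
    · refine tendstoUOC_iff.2 fun T hT ε hε => ?_
      filter_upwards [tendstoUOC_iff.1 (hA i) T hT ε hε] with n hn t ht
      simpa using hn t ht
  have hDL : ∀ p : I × J, ∃ K, IsAsymptoticallyLipschitz K
      (fun n t => (completions net (r n) (S n) (Z n) p.1 p.2 t : ℝ) / r n) := by
    rintro ⟨i, j⟩
    by_cases hij : (i, j) ∈ net.E
    · have hμ := net.mu_pos _ hij
      have hβ := net.beta_pos j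
      refine ⟨⟨net.mu i j * net.beta j, (mul_pos hμ hβ).le⟩, .of_approx
        (g := fun n t => net.mu i j * serviceTime (r n) (Z n) i j t) (fun n s hs t hst => ?_)
        (IsDrivenPath.tendstoUOC_completions h hS hij)⟩
      have hm := (h n).serviceTime_sub i j hs hst
      rw [← mul_sub, abs_of_nonneg (mul_nonneg hμ.le hm.1)]
      refine (mul_le_mul_of_nonneg_left hm.2 hμ.le).trans (le_of_eq ?_)
      change _ = net.mu i j * net.beta j * (t - s)
      ring
    · refine ⟨0, fun T _ ε hε => Eventually.of_forall fun n s _ t _ => ?_⟩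
      simpa [completions, hij] using hε.le
  choose KA hKA using hAL
  choose KD hKD using hDL
  refine ⟨_, ((IsAsymptoticallyLipschitz.sum Finset.univ fun i _ => hKA i).add
    (IsAsymptoticallyLipschitz.sum Finset.univ fun p _ => hKD p)).mono fun n s hs t hst => ?_⟩
  rw [← Finset.sum_div, ← Finset.sum_div, ← Finset.sum_div, ← Finset.sum_div, ← add_div,
    ← add_div, ← sub_div, ← sub_div]
  refine le_of_eq (abs_of_nonneg (div_nonneg (sub_nonneg.2 ?_) (h n).r_pos.le))
  exact (h n).le_of_transition_le Config.events hs hst fun _ _ _ hc => hc.events_le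

/-- A sequence of systems whose drivers obey the law of large numbers, and whose scaled queues and
numbers of busy servers converge. -/
structure HasFluidLimit (net : Network I J) (r : ℕ → ℝ) (size : ℕ → J → ℕ)
    (A : ℕ → I → ℝ → ℕ) (S : ℕ → net.E → ℝ → ℕ) (Z : ℕ → ℝ → State I J)
    (q : I → ℝ → ℝ) (psi : I → J → ℝ → ℝ) : Prop where
  driven : ∀ n, IsDrivenPath net (r n) (size n) (A n) (S n) (Z n)
  arrivals : ∀ i, TendstoUOC (fun n t => (A n i t : ℝ) / r n) (fun t => net.lam i * t)
  services : ∀ e, TendstoUOC (fun n t => (S n e t : ℝ) / r n) (fun t => net.mu e.1.1 e.1.2 * t)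
  queue : ∀ i, TendstoUOC (fun n t => ((Z n t).queue i : ℝ) / r n) (q i)
  busy : ∀ i j, TendstoUOC (fun n t => ((Z n t).busy i j : ℝ) / r n) (psi i j)
  lipschitz_queue : ∀ i, ∃ K, LipschitzOnWith K (q i) (Set.Ici 0)
  lipschitz_busy : ∀ i j, ∃ K, LipschitzOnWith K (psi i j) (Set.Ici 0)

theorem LipschitzOnWith.exists_sum {ι : Type*} {G : ι → ℝ → ℝ} {s : Set ℝ} (u : Finset ι)
    (h : ∀ i ∈ u, ∃ K, LipschitzOnWith K (G i) s) :
    ∃ K, LipschitzOnWith K (fun t => ∑ i ∈ u, G i t) s := by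
  classical
  induction u using Finset.induction_on with
  | empty => exact ⟨0, by simp⟩
  | insert i u hi ih =>
    simp only [Finset.sum_insert hi]
    obtain ⟨K, hK⟩ := h i (Finset.mem_insert_self i u)
    obtain ⟨K', hK'⟩ := ih fun k hk => h k (Finset.mem_insert_of_mem hk)
    exact ⟨K + K', hK.add hK'⟩

/-! ### The fluid limit satisfies the fluid model equations -/

namespace HasFluidLimit

variable {net : Network I J} {r : ℕ → ℝ} {size : ℕ → J → ℕ} {A : ℕ → I → ℝ → ℕ}
  {S : ℕ → net.E → ℝ → ℕ} {Z : ℕ → ℝ → State I J} {q : I → ℝ → ℝ} {psi : I → J → ℝ → ℝ}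

theorem continuousOn_queue (h : HasFluidLimit net r size A S Z q psi) (i : I) :
    ContinuousOn (q i) (Set.Ici 0) := by
  obtain ⟨K, hK⟩ := h.lipschitz_queue i
  exact hK.continuousOn

theorem continuousOn_busy (h : HasFluidLimit net r size A S Z q psi) (i : I) (j : J) :
    ContinuousOn (psi i j) (Set.Ici 0) := by
  obtain ⟨K, hK⟩ := h.lipschitz_busy i j
  exact hK.continuousOn

theorem intervalIntegrable_busy (h : HasFluidLimit net r size A S Z q psi) (i : I) (j : J) {t : ℝ}
    (ht : 0 ≤ t) : IntervalIntegrable (psi i j) volume 0 t :=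
  ((h.continuousOn_busy i j).mono (by
    rw [Set.uIcc_of_le ht]; exact Set.Icc_subset_Ici_self)).intervalIntegrable

theorem tendstoUOC_total (h : HasFluidLimit net r size A S Z q psi) (i : I) :
    TendstoUOC (fun n t => ((Z n t).total net i : ℝ) / r n)
      (fun t => q i t + ∑ j ∈ net.S i, psi i j t) := by
  have := (h.queue i).add (TendstoUOC.sum (net.S i) fun j _ => h.busy i j)
  simpa only [State.total, Nat.cast_add, Nat.cast_sum, add_div, Finset.sum_div] using this

theorem tendstoUOC_load (h : HasFluidLimit net r size A S Z q psi) (j : J) :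
    TendstoUOC (fun n t => (Z n t).load net j / r n)
      (fun t => 1 / net.beta j * ∑ i ∈ net.C j, psi i j t) := by
  have := (TendstoUOC.sum (net.C j) fun i _ => h.busy i j).const_mul (1 / net.beta j)
  convert this using 3 with n t
  rw [State.load, State.poolBusy, Nat.cast_sum, ← Finset.sum_div]
  ring

theorem continuousOn_load (h : HasFluidLimit net r size A S Z q psi) (j : J) :
    ContinuousOn (fun t => 1 / net.beta j * ∑ i ∈ net.C j, psi i j t) (Set.Ici 0) :=
  continuousOn_const.mul (continuousOn_finsetSum _ fun i _ => h.continuousOn_busy i j)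

/-- Dominated convergence, with the scaled pool size `β_j` as the bound. -/
theorem tendsto_serviceTime (h : HasFluidLimit net r size A S Z q psi) (i : I) (j : J) {t : ℝ}
    (ht : 0 ≤ t) :
    Tendsto (fun n => IsDrivenPath.serviceTime (r n) (Z n) i j t) atTop
      (𝓝 (∫ s in (0 : ℝ)..t, psi i j s)) := by
  have heq : ∀ n, IsDrivenPath.serviceTime (r n) (Z n) i j t =
      ∫ s in (0 : ℝ)..t, ((Z n s).busy i j : ℝ) / r n := fun n => by
    rw [IsDrivenPath.serviceTime, intervalIntegral.integral_div, div_eq_inv_mul]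
  simp only [heq]
  refine intervalIntegral.tendsto_integral_filter_of_dominated_convergence (fun _ => net.beta j)
    ?_ ?_ intervalIntegrable_const ?_
  · refine Eventually.of_forall fun n => ?_
    exact (((h.driven n).intervalIntegrable_busy i j le_rfl ht).div_const
      (r n)).def'.aestronglyMeasurable
  · refine Eventually.of_forall fun n => Eventually.of_forall fun s hs => ?_
    rw [Set.uIoc_of_le ht] at hs
    have hr := (h.driven n).r_pos
    rw [Real.norm_of_nonneg (by positivity), div_le_iff₀ hr, mul_comm]
    exact (h.driven n).busy_le i j hs.1.le
  · refine Eventually.of_forall fun s hs => ?_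
    rw [Set.uIoc_of_le ht] at hs
    exact (h.busy i j).tendsto hs.1.le

theorem tendsto_completions (h : HasFluidLimit net r size A S Z q psi) {i : I} {j : J}
    (hij : (i, j) ∈ net.E) {t : ℝ} (ht : 0 ≤ t) :
    Tendsto (fun n => (completions net (r n) (S n) (Z n) i j t : ℝ) / r n) atTop
      (𝓝 (net.mu i j * ∫ s in (0 : ℝ)..t, psi i j s)) := by
  have h1 := (IsDrivenPath.tendstoUOC_completions h.driven h.services hij).tendsto ht
  have h2 := h1.add ((h.tendsto_serviceTime i j ht).const_mul (net.mu i j))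
  simpa using h2

theorem hasDerivWithinAt_integral (h : HasFluidLimit net r size A S Z q psi) (i : I) (j : J) {t : ℝ}
    (ht : 0 ≤ t) :
    HasDerivWithinAt (fun u => ∫ s in (0 : ℝ)..u, psi i j s) (psi i j t) (Set.Ici t) t := by
  have hc : ContinuousOn (psi i j) (Set.Ioi t) :=
    (h.continuousOn_busy i j).mono fun u hu => ht.trans (le_of_lt hu)
  exact intervalIntegral.integral_hasDerivWithinAt_right (h.intervalIntegrable_busy i j ht)
    (hc.stronglyMeasurableAtFilter_nhdsWithin measurableSet_Ioi t)
    ((h.continuousOn_busy i j t ht).mono fun u hu => ht.trans (le_of_lt hu))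

theorem balance (h : HasFluidLimit net r size A S Z q psi) (i : I) {t : ℝ} (ht : 0 ≤ t) :
    q i t + ∑ j ∈ net.S i, psi i j t =
      q i 0 + ∑ j ∈ net.S i, psi i j 0 + net.lam i * t -
        ∑ j ∈ net.S i, ∫ s in (0 : ℝ)..t, net.mu i j * psi i j s := by
  simp only [intervalIntegral.integral_const_mul]
  refine tendsto_nhds_unique ((h.tendstoUOC_total i).tendsto ht) ?_
  have h1 := (((h.tendstoUOC_total i).tendsto le_rfl).add ((h.arrivals i).tendsto ht)).sub
    (tendsto_finsetSum (net.S i) fun j hj => h.tendsto_completions (Network.mem_S.1 hj) ht)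
  refine h1.congr fun n => ?_
  rw [(h.driven n).total_eq i ht, ← Finset.sum_div]
  ring

/-- For large `n` the queue of type `i` is nonempty, so pool `j` is full and its scaled load is
exactly one. -/
theorem work_conservation (h : HasFluidLimit net r size A S Z q psi) {i : I} {j : J}
    (hi : i ∈ net.C j) {t : ℝ} (ht : 0 ≤ t) (hq : 0 < q i t) :
    1 / net.beta j * ∑ i ∈ net.C j, psi i j t = 1 := by
  refine tendsto_nhds_unique ((h.tendstoUOC_load j).tendsto ht)
    (tendsto_const_nhds.congr' ?_)
  filter_upwards [((h.queue i).tendsto ht).eventually_const_lt hq] with n hn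
  have hr := (h.driven n).r_pos
  have hβ := net.beta_pos j
  have hpos : 0 < (Z n t).queue i := by
    have := (div_pos_iff_of_pos_right hr).1 hn
    exact_mod_cast this
  rw [State.load, ((h.driven n).feasible ht).nonidling i hpos j
    (Network.mem_S.2 (Network.mem_C.1 hi)), (h.driven n).size_eq]
  field_simp

/-- An increment identity for the fluid limit, valid on some interval to the right of `t`, implies
the corresponding identity for right derivatives at `t`. -/
theorem deriv_eq_of_increments {F G : ℝ → ℝ} {F' G' t b : ℝ} (hb : t < b)
    (hF : HasDerivWithinAt F F' (Set.Ici t) t) (hG : HasDerivWithinAt G G' (Set.Ici t) t)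
    (h : ∀ u ∈ Set.Icc t b, F u - F t = G u - G t) : F' = G' := by
  have h1 : HasDerivWithinAt F G' (Set.Ici t) t := by
    refine (hG.add_const (F t - G t)).congr_of_eventuallyEq ?_ (by ring)
    filter_upwards [Icc_mem_nhdsGE hb] with u hu
    linarith [h u hu]
  exact (uniqueDiffWithinAt_Ici t).eq_deriv _ hF h1

theorem longest_queue (h : HasFluidLimit net r size A S Z q psi) (Is : Finset I) (Js : Finset J)
    {t : ℝ} (ht : 0 ≤ t) (hpos : ∀ i ∈ Is, 0 < q i t)
    (hlt : ∀ i ∈ Is, ∀ i' ∉ Is, (net.S i ∩ net.S i' ∩ Js).Nonempty → q i' t < q i t)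
    (dpsi : I → J → ℝ)
    (hd : ∀ i ∈ Is, ∀ j ∈ net.S i ∩ Js,
      HasDerivWithinAt (psi i j) (dpsi i j) (Set.Ici 0) t) :
    ∑ i ∈ Is, ∑ j ∈ net.S i ∩ Js, dpsi i j =
      (∑ j ∈ Is.biUnion (fun i => net.S i ∩ Js), ∑ i' ∈ net.C j, net.mu i' j * psi i' j t) -
        ∑ i ∈ Is, ∑ j ∈ net.S i ∩ Js, net.mu i j * psi i j t := by
  -- The strict inequalities at `t` are transferred to the unscaled queues, for all large `n` on an
  -- interval `[t, b]` that does not depend on `n`.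
  have e1 : ∀ᶠ p in atTop ×ˢ 𝓝[≥] t, ∀ i ∈ Is, 0 < (Z p.1 p.2).queue i := by
    refine (Finset.eventually_all Is).2 fun i hi => ?_
    filter_upwards [((h.queue i).tendsto_prod (h.continuousOn_queue i) ht).eventually_const_lt
      (hpos i hi)] with p hp
    exact_mod_cast (div_pos_iff_of_pos_right (h.driven p.1).r_pos).1 hp
  have e2 : ∀ᶠ p in atTop ×ˢ 𝓝[≥] t, ∀ i ∈ Is, ∀ i' ∉ Is, (net.S i ∩ net.S i' ∩ Js).Nonempty →
      (Z p.1 p.2).queue i' < (Z p.1 p.2).queue i := by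
    refine (Finset.eventually_all Is).2 fun i hi => eventually_all.2 fun i' => ?_
    by_cases hc : i' ∉ Is ∧ (net.S i ∩ net.S i' ∩ Js).Nonempty
    · filter_upwards [(h.queue i').eventually_lt (h.queue i) (h.continuousOn_queue i')
        (h.continuousOn_queue i) ht (hlt i hi i' hc.1 hc.2)] with p hp _ _
      exact_mod_cast (div_lt_div_iff_of_pos_right (h.driven p.1).r_pos).1 hp
    · exact Eventually.of_forall fun p h1 h2 => absurd ⟨h1, h2⟩ hc
  obtain ⟨b, hb, hev⟩ := exists_Icc_of_eventually_prod
    (p := fun n u => (∀ i ∈ Is, 0 < (Z n u).queue i) ∧ ∀ i ∈ Is, ∀ i' ∉ Is,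
      (net.S i ∩ net.S i' ∩ Js).Nonempty → (Z n u).queue i' < (Z n u).queue i) (e1.and e2)
  have hdI : Set.Ici t ⊆ Set.Ici 0 := Set.Ici_subset_Ici.2 ht
  -- The left side has right derivatives at `t` by assumption, the right side by the fundamental
  -- theorem of calculus; it remains to prove the identity of increments as a limit.
  refine deriv_eq_of_increments hb
    (HasDerivWithinAt.fun_sum fun i hi => HasDerivWithinAt.fun_sum fun j hj =>
      (hd i hi j hj).mono hdI)
    ((HasDerivWithinAt.fun_sum fun j _ => HasDerivWithinAt.fun_sum fun i' _ =>
      (h.hasDerivWithinAt_integral i' j ht).const_mul (net.mu i' j)).fun_sub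
      (HasDerivWithinAt.fun_sum fun i _ => HasDerivWithinAt.fun_sum fun j _ =>
        (h.hasDerivWithinAt_integral i j ht).const_mul (net.mu i j))) fun u hu => ?_
  have hu0 : 0 ≤ u := ht.trans hu.1
  have hl := tendsto_finsetSum Is fun i _ => tendsto_finsetSum (net.S i ∩ Js) fun j _ =>
    ((h.busy i j).tendsto hu0).sub ((h.busy i j).tendsto ht)
  have hr1 := tendsto_finsetSum (Is.biUnion fun i => net.S i ∩ Js) fun j _ =>
    tendsto_finsetSum (net.C j) fun i hi =>
      (h.tendsto_completions (Network.mem_C.1 hi) hu0).sub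
        (h.tendsto_completions (Network.mem_C.1 hi) ht)
  have hr2 := tendsto_finsetSum Is fun i _ => tendsto_finsetSum (net.S i ∩ Js) fun j hj =>
    (h.tendsto_completions (Network.mem_S.1 (Finset.mem_inter.1 hj).1) hu0).sub
      (h.tendsto_completions (Network.mem_S.1 (Finset.mem_inter.1 hj).1) ht)
  have key := tendsto_nhds_unique_of_eventuallyEq hl (hr1.sub hr2) (by
    filter_upwards [hev] with n hn
    have h1 := (h.driven n).longest_queue ht hu.1
      (fun v hv => (hn v ⟨hv.1, hv.2.trans hu.2⟩).1) (fun v hv => (hn v ⟨hv.1, hv.2.trans hu.2⟩).2)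
    simp only [← sub_div, ← Finset.sum_div]
    rw [h1])
  simp only [Finset.sum_sub_distrib] at key ⊢
  linarith

theorem freest_server (h : HasFluidLimit net r size A S Z q psi) (Is : Finset I) (Js : Finset J)
    {t : ℝ} (ht : 0 ≤ t) {rho : J → ℝ → ℝ}
    (hrho : ∀ j, rho j = fun t => 1 / net.beta j * ∑ i ∈ net.C j, psi i j t)
    (hfree : ∀ j ∈ Js, rho j t < 1)
    (hlt : ∀ j ∈ Js, ∀ j' ∉ Js, (net.C j ∩ net.C j' ∩ Is).Nonempty → rho j t < rho j' t)
    (dpsi : I → J → ℝ)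
    (hd : ∀ j ∈ Js, ∀ i ∈ net.C j ∩ Is,
      HasDerivWithinAt (psi i j) (dpsi i j) (Set.Ici 0) t) :
    ∑ j ∈ Js, ∑ i ∈ net.C j ∩ Is, dpsi i j =
      (∑ i ∈ Js.biUnion (fun j => net.C j ∩ Is), net.lam i) -
        ∑ j ∈ Js, ∑ i ∈ net.C j ∩ Is, net.mu i j * psi i j t := by
  have hload : ∀ j, TendstoUOC (fun n t => (Z n t).load net j / r n) (rho j) := fun j => by
    rw [hrho]; exact h.tendstoUOC_load j
  have hcont : ∀ j, ContinuousOn (rho j) (Set.Ici 0) := fun j => by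
    rw [hrho]; exact h.continuousOn_load j
  have e1 : ∀ᶠ p in atTop ×ˢ 𝓝[≥] t, ∀ j ∈ Js, (Z p.1 p.2).poolBusy net j < size p.1 j := by
    refine (Finset.eventually_all Js).2 fun j hj => ?_
    filter_upwards [((hload j).tendsto_prod (hcont j) ht).eventually_lt_const (hfree j hj)]
      with p hp
    -- A scaled load below one means fewer than `r β_j` busy servers.
    rw [div_lt_one (h.driven p.1).r_pos, State.load, div_lt_iff₀ (net.beta_pos j),
      ← (h.driven p.1).size_eq] at hp
    exact_mod_cast hp
  have e2 : ∀ᶠ p in atTop ×ˢ 𝓝[≥] t, ∀ j ∈ Js, ∀ j' ∉ Js, (net.C j ∩ net.C j' ∩ Is).Nonempty →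
      (Z p.1 p.2).load net j < (Z p.1 p.2).load net j' := by
    refine (Finset.eventually_all Js).2 fun j hj => eventually_all.2 fun j' => ?_
    by_cases hc : j' ∉ Js ∧ (net.C j ∩ net.C j' ∩ Is).Nonempty
    · filter_upwards [(hload j).eventually_lt (hload j') (hcont j) (hcont j') ht
        (hlt j hj j' hc.1 hc.2)] with p hp _ _
      exact (div_lt_div_iff_of_pos_right (h.driven p.1).r_pos).1 hp
    · exact Eventually.of_forall fun p h1 h2 => absurd ⟨h1, h2⟩ hc
  obtain ⟨b, hb, hev⟩ := exists_Icc_of_eventually_prod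
    (p := fun n u => (∀ j ∈ Js, (Z n u).poolBusy net j < size n j) ∧ ∀ j ∈ Js, ∀ j' ∉ Js,
      (net.C j ∩ net.C j' ∩ Is).Nonempty → (Z n u).load net j < (Z n u).load net j') (e1.and e2)
  have hdI : Set.Ici t ⊆ Set.Ici 0 := Set.Ici_subset_Ici.2 ht
  have hlam : ∀ i, HasDerivWithinAt (fun u => net.lam i * u) (net.lam i) (Set.Ici t) t := fun i => by
    simpa using (hasDerivWithinAt_id t (Set.Ici t)).const_mul (net.lam i)
  refine deriv_eq_of_increments hb
    (HasDerivWithinAt.fun_sum fun j hj => HasDerivWithinAt.fun_sum fun i hi =>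
      (hd j hj i hi).mono hdI)
    ((HasDerivWithinAt.fun_sum fun i _ => hlam i).fun_sub
      (HasDerivWithinAt.fun_sum fun j _ => HasDerivWithinAt.fun_sum fun i _ =>
        (h.hasDerivWithinAt_integral i j ht).const_mul (net.mu i j))) fun u hu => ?_
  have hu0 : 0 ≤ u := ht.trans hu.1
  have hl := tendsto_finsetSum Js fun j _ => tendsto_finsetSum (net.C j ∩ Is) fun i _ =>
    ((h.busy i j).tendsto hu0).sub ((h.busy i j).tendsto ht)
  have hr1 := tendsto_finsetSum (Js.biUnion fun j => net.C j ∩ Is) fun i _ =>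
    ((h.arrivals i).tendsto hu0).sub ((h.arrivals i).tendsto ht)
  have hr2 := tendsto_finsetSum Js fun j _ => tendsto_finsetSum (net.C j ∩ Is) fun i hi =>
    (h.tendsto_completions (Network.mem_C.1 (Finset.mem_inter.1 hi).1) hu0).sub
      (h.tendsto_completions (Network.mem_C.1 (Finset.mem_inter.1 hi).1) ht)
  have key := tendsto_nhds_unique_of_eventuallyEq hl (hr1.sub hr2) (by
    filter_upwards [hev] with n hn
    have h1 := (h.driven n).freest_server ht hu.1
      (fun v hv => (hn v ⟨hv.1, hv.2.trans hu.2⟩).1) (fun v hv => (hn v ⟨hv.1, hv.2.trans hu.2⟩).2)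
    simp only [← sub_div, ← Finset.sum_div]
    rw [h1])
  simp only [Finset.sum_sub_distrib] at key ⊢
  linarith

theorem isFluidModel (h : HasFluidLimit net r size A S Z q psi) :
    IsFluidModel net (fun i t => net.lam i * t) (fun i t => q i t + ∑ j ∈ net.S i, psi i j t) q psi
      (fun j t => 1 / net.beta j * ∑ i ∈ net.C j, psi i j t) where
  lipschitz_a i := ⟨_, (lipschitzWith_smul (β := ℝ) (net.lam i)).lipschitzOnWith⟩
  lipschitz_x i := by
    obtain ⟨K, hK⟩ := h.lipschitz_queue i
    obtain ⟨K', hK'⟩ := LipschitzOnWith.exists_sum (net.S i) fun j _ => h.lipschitz_busy i j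
    exact ⟨_, hK.add hK'⟩
  lipschitz_q := h.lipschitz_queue
  lipschitz_psi i j _ := h.lipschitz_busy i j
  lipschitz_rho j := by
    obtain ⟨K, hK⟩ := LipschitzOnWith.exists_sum (net.C j) fun i _ => h.lipschitz_busy i j
    exact ⟨_, (lipschitzWith_smul (1 / net.beta j)).comp_lipschitzOnWith hK⟩
  arrivals _ _ _ := rfl
  total _ _ _ := rfl
  balance i _ ht := h.balance i ht
  load _ _ _ := rfl
  work_conservation _ _ ht := fun ⟨_, hi, hq⟩ => h.work_conservation hi ht hq
  longest_queue Is Js _ ht := h.longest_queue Is Js ht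
  freest_server Is Js _ ht := h.freest_server Is Js ht fun _ => rfl

end HasFluidLimit

/-! ### Existence of fluid limits and proof of the theorem -/

open IsDrivenPath in
theorem IsDrivenPath.exists_hasFluidLimit {net : Network I J} {r : ℕ → ℝ}
    {size : ℕ → J → ℕ} {A : ℕ → I → ℝ → ℕ} {S : ℕ → net.E → ℝ → ℕ} {Z : ℕ → ℝ → State I J}
    (h : ∀ n, IsDrivenPath net (r n) (size n) (A n) (S n) (Z n))
    (hA : ∀ i, TendstoUOC (fun n t => (A n i t : ℝ) / r n) (fun t => net.lam i * t))
    (hS : ∀ e, TendstoUOC (fun n t => (S n e t : ℝ) / r n) (fun t => net.mu e.1.1 e.1.2 * t))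
    {q₀ : I → ℝ} (hq₀ : ∀ i, Tendsto (fun n => ((Z n 0).queue i : ℝ) / r n) atTop (𝓝 (q₀ i))) :
    ∃ θ : ℕ → ℕ, StrictMono θ ∧ ∃ q psi, HasFluidLimit net (fun n => r (θ n))
      (fun n => size (θ n)) (fun n => A (θ n)) (fun n => S (θ n)) (fun n => Z (θ n)) q psi := by
  obtain ⟨K, hK⟩ := IsDrivenPath.exists_asymptoticallyLipschitz_events h hA hS
  have hosc : ∀ G : Config I J → ℝ,
      (∀ n (c c' : Config I J), c.Transition net (size n) c' → |G c' - G c| ≤ c'.events - c.events) →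
      IsAsymptoticallyLipschitz K
        (fun n t => G (config net (r n) (A n) (S n) (Z n) t) / r n) := by
    refine fun G hG => hK.mono fun n s hs t hst => ?_
    have hr := (h n).r_pos
    rw [← sub_div, ← sub_div, abs_div, abs_of_pos hr]
    have := (h n).abs_sub_le_events G (hG n) hs hst
    gcongr
  -- Queues and busy counts share the constant of the event count, so one extraction handles the
  -- joint family. At time zero the busy counts are bounded by capacity and the queues by their
  -- convergence.
  obtain ⟨θ, l, hθ, hl⟩ := IsAsymptoticallyLipschitz.exists_subseq_tendstoUOC (K := K)
    (F := Sum.elim (fun (i : I) n t => ((Z n t).queue i : ℝ) / r n)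
      (fun (p : I × J) n t => ((Z n t).busy p.1 p.2 : ℝ) / r n)) (by
      rintro (i | p)
      · exact hosc (fun c => c.state.queue i) fun n c c' hc => hc.abs_queue_sub_le i
      · exact hosc (fun c => c.state.busy p.1 p.2) fun n c c' hc => hc.abs_busy_sub_le p.1 p.2) (by
      rintro (i | p)
      · exact ⟨|q₀ i| + 1, ((hq₀ i).abs.eventually_lt_const (lt_add_one _)).mono fun n hn => hn.le⟩
      · refine ⟨net.beta p.2, Eventually.of_forall fun n => ?_⟩
        have hr := (h n).r_pos
        simp only [Sum.elim_inr]
        rw [abs_of_nonneg (by positivity), div_le_iff₀ hr, mul_comm]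
        exact (h n).busy_le p.1 p.2 le_rfl)
  have hθt := hθ.tendsto_atTop
  exact ⟨θ, hθ, fun i => l (.inl i), fun i j => l (.inr (i, j)),
    { driven := fun n => h (θ n)
      arrivals := fun i => (hA i).comp_tendsto hθt
      services := fun e => (hS e).comp_tendsto hθt
      queue := fun i => (hl (.inl i)).2
      busy := fun i j => (hl (.inr (i, j))).2
      lipschitz_queue := fun i => ⟨K, (hl (.inl i)).1⟩
      lipschitz_busy := fun i j => ⟨K, (hl (.inr (i, j))).1⟩ }⟩

theorem right_locally_constant_comp_toNNReal {N : ℝ≥0 → ℕ}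
    (hN : ∀ t, ContinuousWithinAt N (Set.Ici t) t) {c : ℝ} (hc : 0 ≤ c) (t : ℝ) :
    ∀ᶠ s in 𝓝[≥] t, N (c * s).toNNReal = N (c * t).toNNReal := by
  have hcont : Continuous fun s : ℝ => (c * s).toNNReal := by fun_prop
  have h1 : Tendsto (fun s : ℝ => (c * s).toNNReal) (𝓝[≥] t) (𝓝[≥] (c * t).toNNReal) := by
    refine tendsto_nhdsWithin_iff.2 ⟨(hcont.tendsto t).mono_left nhdsWithin_le_nhds, ?_⟩
    filter_upwards [self_mem_nhdsWithin] with s hs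
    exact Real.toNNReal_le_toNNReal (mul_le_mul_of_nonneg_left hs hc)
  have h2 := hN (c * t).toNNReal
  rw [ContinuousWithinAt, nhds_discrete, tendsto_pure] at h2
  -- The values lie in the discrete space `ℕ`, where right-continuity means being constant on a
  -- right neighbourhood.
  exact h1.eventually h2

end LQFS

theorem mainTheorem12 {I J Ω : Type*} [Fintype I] [DecidableEq I] [Fintype J] [DecidableEq J]
    [MeasurableSpace Ω] (P : Measure Ω) [IsProbabilityMeasure P]
    (net : LQFS.Network I J)
    -- the scaling parameters, the arrival rates and the pool sizes of the sequence of systems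
    (r : ℕ → ℝ) (hr_pos : ∀ n, 0 < r n) (hr : Tendsto r atTop atTop)
    (lamr : ℕ → I → ℝ) (hlamr_nonneg : ∀ n i, 0 ≤ lamr n i)
    (hlamr : ∀ i, (fun n => lamr n i - r n * net.lam i) =o[atTop] r)
    (size : ℕ → J → ℕ) (hsize : ∀ n j, (size n j : ℝ) = r n * net.beta j)
    -- the independent unit-rate Poisson processes
    (Pa : I → ℝ≥0 → Ω → ℕ) (Ps : net.E → ℝ≥0 → Ω → ℕ)
    (hPa : ∀ i, LQFS.IsUnitPoissonProcess P (Pa i))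
    (hPs : ∀ e, LQFS.IsUnitPoissonProcess P (Ps e))
    (hindep : iIndepFun (fun (k : I ⊕ net.E) (ω : Ω) (t : ℝ≥0) => Sum.elim Pa Ps k t ω) P)
    -- the arrival and the potential service processes of the systems
    (A : ℕ → I → ℝ → Ω → ℕ)
    (hA : ∀ n i t ω, A n i t ω = Pa i (lamr n i * t).toNNReal ω)
    (S : ℕ → net.E → ℝ → Ω → ℕ)
    (hS : ∀ n e t ω, S n e t ω = Ps e (net.mu e.1.1 e.1.2 * r n * t).toNNReal ω)
    -- the processes under LQFS-LB
    (Z : ℕ → ℝ → Ω → LQFS.State I J)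
    (hZ : ∀ᵐ ω ∂P, ∀ n, LQFS.IsLQFSPath net (r n) (size n)
      (fun i t => A n i t ω) (fun e t => S n e t ω) (fun t => Z n t ω))
    -- convergence of the fluid-scaled initial states
    (x₀ q₀ : Ω → I → ℝ) (psi₀ : Ω → I → J → ℝ) (rho₀ : Ω → J → ℝ)
    (h₀ : ∀ᵐ ω ∂P,
      (∀ i, Tendsto (fun n => ((Z n 0 ω).total net i : ℝ) / r n) atTop (𝓝 (x₀ ω i))) ∧
      (∀ i, Tendsto (fun n => ((Z n 0 ω).queue i : ℝ) / r n) atTop (𝓝 (q₀ ω i))) ∧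
      (∀ i, ∀ j ∈ net.S i,
        Tendsto (fun n => ((Z n 0 ω).busy i j : ℝ) / r n) atTop (𝓝 (psi₀ ω i j))) ∧
      (∀ j, Tendsto (fun n => (Z n 0 ω).load net j / r n) atTop (𝓝 (rho₀ ω j)))) :
    ∀ᵐ ω ∂P, ∀ φ : ℕ → ℕ, StrictMono φ → ∃ θ : ℕ → ℕ, StrictMono θ ∧
      ∃ (a x q : I → ℝ → ℝ) (psi : I → J → ℝ → ℝ) (rho : J → ℝ → ℝ),
        LQFS.IsFluidModel net a x q psi rho ∧
        -- the fluid model starts from the limit of the initial states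
        ((∀ i, x i 0 = x₀ ω i) ∧ (∀ i, q i 0 = q₀ ω i) ∧
          (∀ i, ∀ j ∈ net.S i, psi i j 0 = psi₀ ω i j) ∧ (∀ j, rho j 0 = rho₀ ω j)) ∧
        -- convergence along the subsequence, uniformly on compact sets
        (∀ i, LQFS.TendstoUOC
          (fun m t => (A (φ (θ m)) i t ω : ℝ) / r (φ (θ m))) (a i)) ∧
        (∀ i, LQFS.TendstoUOC
          (fun m t => ((Z (φ (θ m)) t ω).total net i : ℝ) / r (φ (θ m))) (x i)) ∧
        (∀ i, LQFS.TendstoUOC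
          (fun m t => ((Z (φ (θ m)) t ω).queue i : ℝ) / r (φ (θ m))) (q i)) ∧
        (∀ i, ∀ j ∈ net.S i, LQFS.TendstoUOC
          (fun m t => ((Z (φ (θ m)) t ω).busy i j : ℝ) / r (φ (θ m))) (psi i j)) ∧
        (∀ j, LQFS.TendstoUOC
          (fun m t => (Z (φ (θ m)) t ω).load net j / r (φ (θ m))) (rho j)) := by
  have hpaths : ∀ᵐ ω ∂P, (∀ i, (Pa i 0 ω = 0 ∧ Monotone (fun t => Pa i t ω) ∧
      ∀ t, ContinuousWithinAt (fun s => Pa i s ω) (Set.Ici t) t) ∧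
      Tendsto (fun n : ℕ => (Pa i n ω : ℝ) / n) atTop (𝓝 1)) ∧
      ∀ e, (Ps e 0 ω = 0 ∧ Monotone (fun t => Ps e t ω) ∧
      ∀ t, ContinuousWithinAt (fun s => Ps e s ω) (Set.Ici t) t) ∧
      Tendsto (fun n : ℕ => (Ps e n ω : ℝ) / n) atTop (𝓝 1) :=
    (ae_all_iff.2 fun i => (hPa i).paths.and (hPa i).ae_tendsto_nat).and
      (ae_all_iff.2 fun e => (hPs e).paths.and (hPs e).ae_tendsto_nat)
  have hlam : ∀ i, Tendsto (fun n => lamr n i / r n) atTop (𝓝 (net.lam i)) := by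
    intro i
    have h1 := ((hlamr i).tendsto_div_nhds_zero).add_const (net.lam i)
    rw [zero_add] at h1
    refine h1.congr fun n => ?_
    have := (hr_pos n).ne'
    field_simp
    ring
  -- The exceptional null set is fixed before `φ`: a single event of probability one serves all
  -- subsequences.
  filter_upwards [hpaths, hZ, h₀] with ω hω hZω h₀ω φ hφ
  obtain ⟨hPaω, hPsω⟩ := hω
  obtain ⟨hx₀, hq₀, hpsi₀, hrho₀⟩ := h₀ω
  have hφt := hφ.tendsto_atTop
  have hdriven : ∀ n, LQFS.IsDrivenPath net (r n) (size n)
      (fun i t => A n i t ω) (fun e t => S n e t ω) (fun t => Z n t ω) := fun n =>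
    { path := hZω n
      r_pos := hr_pos n
      size_eq := hsize n
      arrivals_zero := fun i => by simp [hA, (hPaω i).1.1]
      services_zero := fun e => by simp [hS, (hPsω e).1.1]
      arrivals_right := fun i t _ => by
        simp only [hA]
        exact LQFS.right_locally_constant_comp_toNNReal (hPaω i).1.2.2 (hlamr_nonneg n i) t
      services_right := fun e t _ => by
        simp only [hS]
        exact LQFS.right_locally_constant_comp_toNNReal (hPsω e).1.2.2
          (mul_nonneg (net.mu_pos _ e.2).le (hr_pos n).le) t }
  have hAω : ∀ i, LQFS.TendstoUOC (fun n t => (A n i t ω : ℝ) / r n) (fun t => net.lam i * t) := by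
    intro i
    simp only [hA]
    exact LQFS.tendstoUOC_scaled_counting (hPaω i).1.2.1 (hPaω i).2 hr_pos hr
      (fun n => hlamr_nonneg n i) (hlam i)
  have hSω : ∀ e : net.E, LQFS.TendstoUOC (fun n t => (S n e t ω : ℝ) / r n)
      (fun t => net.mu e.1.1 e.1.2 * t) := by
    intro e
    simp only [hS]
    refine LQFS.tendstoUOC_scaled_counting (hPsω e).1.2.1 (hPsω e).2 hr_pos hr
      (fun n => mul_nonneg (net.mu_pos _ e.2).le (hr_pos n).le) ?_
    refine tendsto_const_nhds.congr fun n => ?_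
    rw [mul_div_cancel_right₀ _ (hr_pos n).ne']
  obtain ⟨θ, hθ, q, psi, hlim⟩ := LQFS.IsDrivenPath.exists_hasFluidLimit
    (fun n => hdriven (φ n)) (fun i => (hAω i).comp_tendsto hφt)
    (fun e => (hSω e).comp_tendsto hφt) (fun i => (hq₀ i).comp hφt)
  have hφθ : Tendsto (fun m => φ (θ m)) atTop atTop := hφt.comp hθ.tendsto_atTop
  -- The initial state of the limit is identified by uniqueness of limits at time zero.
  refine ⟨θ, hθ, _, _, q, psi, _, hlim.isFluidModel, ⟨fun i => ?_, fun i => ?_, fun i j hj => ?_,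
    fun j => ?_⟩, hlim.arrivals, hlim.tendstoUOC_total, hlim.queue, fun i j _ => hlim.busy i j,
    hlim.tendstoUOC_load⟩
  · exact tendsto_nhds_unique ((hlim.tendstoUOC_total i).tendsto le_rfl) ((hx₀ i).comp hφθ)
  · exact tendsto_nhds_unique ((hlim.queue i).tendsto le_rfl) ((hq₀ i).comp hφθ)
  · exact tendsto_nhds_unique ((hlim.busy i j).tendsto le_rfl) ((hpsi₀ i j hj).comp hφθ)
  · exact tendsto_nhds_unique ((hlim.tendstoUOC_load j).tendsto le_rfl) ((hrho₀ j).comp hφθ)
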